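/- Let $G=(V,E)$ be a finite simple graph with $n$ vertices and $m$ edges, and let $S$ be a spanning caterpillar of $G$, that is, a spanning tree of $G$ such that removing all vertices of degree one of $S$ (the leaves) results in a (possibly empty) path, the spine. Then $G$ has a straight-line drawing $\Gamma$ in the plane (vertices are distinct points, edges are straight segments that contain no vertices other than their ends) in which no edge of $S$ is crossed: an edge of $S$ and any other edge of $G$ have no point in common except possibly a common end-vertex. Moreover, $\Gamma$ can be chosen such that 1. the spine vertices of $S$ lie on a quarter of a circle, all leaves of $S$ lie strictly inside this circle, and the leaves of each spine vertex lie on a common circular arc; 2. any two vertices have Euclidean distance at least $1$, and the axis-parallel bounding box of $\Gamma$ has area $O(n^2)$; 3. $\Gamma$ is computed in $O(n+m)$ time in the real RAM model with unit-cost arithmetic, square roots and basic trigonometric functions: there is one program that, given $n$ and the lists of the edges of $G$ and of $S$ in arbitrary order, outputs the coordinates of the vertices of such a drawing after at most $C\,(n+m)$ steps. The constants, including $C$, are absolute. -/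

import Mathlib

/-! ## Straight-line drawings -/

/-- The Euclidean plane. -/
abbrev Plane : Type := EuclideanSpace ℝ (Fin 2)

/-- `pos` is a straight-line drawing of `G`: vertices are distinct points, each edge is the closed
segment between its end-vertices, and no edge passes through a vertex other than its ends. -/
structure IsStraightLineDrawing {V : Type*} (G : SimpleGraph V) (pos : V → Plane) : Prop where
  injective : Function.Injective pos
  no_vertex_on_edge : ∀ a b v : V, G.Adj a b → v ≠ a → v ≠ b →
    pos v ∉ segment ℝ (pos a) (pos b)

/-- `pos` is a straight-line compatible drawing of `⟨G, S⟩`: a straight-line drawing of `G` in which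
an edge of `S` meets another edge of `G` at most in a common end-vertex of the two edges. -/
structure IsCompatibleDrawing {V : Type*} (G S : SimpleGraph V) (pos : V → Plane) : Prop where
  drawing : IsStraightLineDrawing G pos
  not_crossed : ∀ a b c d : V, S.Adj a b → G.Adj c d → s(a, b) ≠ s(c, d) →
    ∀ p ∈ segment ℝ (pos a) (pos b), p ∈ segment ℝ (pos c) (pos d) →
      ∃ w : V, w ∈ s(a, b) ∧ w ∈ s(c, d) ∧ p = pos w

/-- The resolution rule: vertices are pairwise at distance at least one. -/
def HasUnitResolution {V : Type*} (pos : V → Plane) : Prop :=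
  ∀ u v : V, u ≠ v → 1 ≤ dist (pos u) (pos v)

/-- The set of all points of the plane that are drawn: all vertices and all edges. -/
def drawnPoints {V : Type*} (G : SimpleGraph V) (pos : V → Plane) : Set Plane :=
  Set.range pos ∪ {p | ∃ a b : V, G.Adj a b ∧ p ∈ segment ℝ (pos a) (pos b)}

/-- The length of the projection of a (nonempty, bounded) set on the `i`-th coordinate axis. -/
noncomputable def extent (X : Set Plane) (i : Fin 2) : ℝ :=
  sSup ((fun p : Plane => p i) '' X) - sInf ((fun p : Plane => p i) '' X)

/-- The area of a drawing: width times height of its smallest axis-parallel enclosing rectangle. -/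
noncomputable def drawingArea {V : Type*} (G : SimpleGraph V) (pos : V → Plane) : ℝ :=
  extent (drawnPoints G pos) 0 * extent (drawnPoints G pos) 1

/-! ## Caterpillars -/

/-- `v` is a leaf of `T`: a vertex of degree one. -/
def IsLeafOf {V : Type*} (T : SimpleGraph V) (v : V) : Prop := ∃! w : V, T.Adj v w

/-- The spine vertices of `T`: those that are not leaves. -/
def spineSet {V : Type*} (T : SimpleGraph V) : Set V := {v | ¬ IsLeafOf T v}

/-- A caterpillar is a tree such that removing all its leaves results in a path. (For the tree with
a single edge, this is the path with `k = 0` vertices.) -/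
def IsCaterpillar {V : Type*} (T : SimpleGraph V) : Prop :=
  T.IsTree ∧ ∃ k : ℕ, Nonempty (T.induce (spineSet T) ≃g SimpleGraph.pathGraph k)

/-- The layout: the spine vertices lie on a quarter of a circle, every leaf lies strictly
inside that circle, and the leaves of each spine vertex lie together on a circular arc. -/
def IsQuarterCircleLayout {V : Type*} (T : SimpleGraph V) (pos : V → Plane) : Prop :=
  ∃ (o : Plane) (r : ℝ), 0 < r ∧
    (∀ u ∈ spineSet T, dist (pos u) o = r ∧ (pos u) 0 ≤ o 0 ∧ o 1 ≤ (pos u) 1) ∧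
    (∀ v : V, IsLeafOf T v → dist (pos v) o < r) ∧
    (∀ u ∈ spineSet T, EuclideanGeometry.Cospherical (pos '' {v | IsLeafOf T v ∧ T.Adj u v}))

/-! ## The real RAM

Programs are `while`-programs over a random access memory. The memory consists of arrays of natural
numbers (used for data such as vertex names and counters, and as addresses) and arrays of real
numbers. A program names only finitely many arrays; scalar variables are array cells with a constant
index. Every operation on exact real numbers takes one step, including `sqrt` and the trigonometric
functions; there is no rounding operation and no conversion from reals to natural numbers, and the
only real constants are natural numbers. The only operations on natural numbers are addition,
truncated subtraction and comparison. -/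

namespace RealRAM

/-- A memory state: `nat a i` and `real a i` are the contents of cell `i` of array `a`. -/
structure State : Type where
  nat : ℕ → ℕ → ℕ
  real : ℕ → ℕ → ℝ

/-- Expressions for natural numbers; `load a i` reads cell `i` of array `a`. -/
inductive NatExpr : Type
  | const (k : ℕ)
  | load (a : ℕ) (i : NatExpr)
  | add (e f : NatExpr)
  | sub (e f : NatExpr)

namespace NatExpr

/-- The value of an expression. -/
def value (s : State) : NatExpr → ℕ
  | const k => k
  | load a i => s.nat a (i.value s)
  | add e f => e.value s + f.value s
  | sub e f => e.value s - f.value s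

/-- The number of steps to evaluate an expression: one for each constant and operation in it. -/
def cost : NatExpr → ℕ
  | const _ => 1
  | load _ i => i.cost + 1
  | add e f => e.cost + f.cost + 1
  | sub e f => e.cost + f.cost + 1

end NatExpr

/-- Expressions for real numbers; `cast e` is a natural number seen as a real number, `load a i`
reads cell `i` of array `a`. -/
inductive RealExpr : Type
  | cast (e : NatExpr)
  | load (a : ℕ) (i : NatExpr)
  | add (x y : RealExpr)
  | sub (x y : RealExpr)
  | mul (x y : RealExpr)
  | div (x y : RealExpr)
  | sqrt (x : RealExpr)
  | sin (x : RealExpr)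
  | cos (x : RealExpr)
  | arctan (x : RealExpr)

namespace RealExpr

/-- The value of an expression. Division by zero and roots of negative numbers give `0`; this adds
no power, since a program can make these case distinctions by a comparison. -/
noncomputable def value (s : State) : RealExpr → ℝ
  | cast e => (e.value s : ℝ)
  | load a i => s.real a (i.value s)
  | add x y => x.value s + y.value s
  | sub x y => x.value s - y.value s
  | mul x y => x.value s * y.value s
  | div x y => x.value s / y.value s
  | sqrt x => Real.sqrt (x.value s)
  | sin x => Real.sin (x.value s)
  | cos x => Real.cos (x.value s)
  | arctan x => Real.arctan (x.value s)

/-- The number of steps to evaluate an expression. -/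
def cost : RealExpr → ℕ
  | cast e => e.cost + 1
  | load _ i => i.cost + 1
  | add x y => x.cost + y.cost + 1
  | sub x y => x.cost + y.cost + 1
  | mul x y => x.cost + y.cost + 1
  | div x y => x.cost + y.cost + 1
  | sqrt x => x.cost + 1
  | sin x => x.cost + 1
  | cos x => x.cost + 1
  | arctan x => x.cost + 1

end RealExpr

/-- Tests. -/
inductive Test : Type
  | natLt (e f : NatExpr)
  | natEq (e f : NatExpr)
  | realLt (x y : RealExpr)
  | not (b : Test)

namespace Test

/-- The test succeeds. -/
def Holds (s : State) : Test → Prop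
  | natLt e f => e.value s < f.value s
  | natEq e f => e.value s = f.value s
  | realLt x y => x.value s < y.value s
  | not b => ¬ b.Holds s

/-- The number of steps to evaluate a test. -/
def cost : Test → ℕ
  | natLt e f => e.cost + f.cost + 1
  | natEq e f => e.cost + f.cost + 1
  | realLt x y => x.cost + y.cost + 1
  | not b => b.cost + 1

end Test

/-- Programs; `setNat a i e` stores the value of `e` in cell `i` of array `a`. -/
inductive Program : Type
  | skip
  | setNat (a : ℕ) (i e : NatExpr)
  | setReal (a : ℕ) (i : NatExpr) (x : RealExpr)
  | seq (p q : Program)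
  | ite (b : Test) (p q : Program)
  | while (b : Test) (p : Program)

/-- The state after storing `k` in cell `i` of the array `a` of natural numbers. -/
def State.storeNat (s : State) (a i k : ℕ) : State :=
  { s with nat := Function.update s.nat a (Function.update (s.nat a) i k) }

/-- The state after storing `x` in cell `i` of the array `a` of real numbers. -/
noncomputable def State.storeReal (s : State) (a i : ℕ) (x : ℝ) : State :=
  { s with real := Function.update s.real a (Function.update (s.real a) i x) }

/-- `Run p s t s'`: program `p`, started in state `s`, halts after exactly `t` steps in
state `s'`. -/
inductive Run : Program → State → ℕ → State → Prop
  | skip (s : State) : Run .skip s 1 s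
  | setNat (s : State) (a : ℕ) (i e : NatExpr) :
      Run (.setNat a i e) s (i.cost + e.cost + 1) (s.storeNat a (i.value s) (e.value s))
  | setReal (s : State) (a : ℕ) (i : NatExpr) (x : RealExpr) :
      Run (.setReal a i x) s (i.cost + x.cost + 1) (s.storeReal a (i.value s) (x.value s))
  | seq {p q : Program} {s s' s'' : State} {t t' : ℕ} :
      Run p s t s' → Run q s' t' s'' → Run (.seq p q) s (t + t') s''
  | ite_true {b : Test} {p q : Program} {s s' : State} {t : ℕ} :
      b.Holds s → Run p s t s' → Run (.ite b p q) s (b.cost + t) s'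
  | ite_false {b : Test} {p q : Program} {s s' : State} {t : ℕ} :
      ¬ b.Holds s → Run q s t s' → Run (.ite b p q) s (b.cost + t) s'
  | while_true {b : Test} {p : Program} {s s' s'' : State} {t t' : ℕ} :
      b.Holds s → Run p s t s' → Run (.while b p) s' t' s'' →
      Run (.while b p) s (b.cost + t + t') s''
  | while_false {b : Test} {p : Program} {s : State} :
      ¬ b.Holds s → Run (.while b p) s b.cost s

end RealRAM

/-! ## Input and output -/

/-- `L` lists every edge of `G` exactly once, in any order and with any order of its two ends. -/
def IsEdgeList {n : ℕ} (G : SimpleGraph (Fin n)) (L : List (Fin n × Fin n)) : Prop :=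
  (L.map fun e => s(e.1, e.2)).Nodup ∧
    ∀ a b : Fin n, s(a, b) ∈ L.map (fun e => s(e.1, e.2)) ↔ G.Adj a b

/-- The initial memory for a graph with vertices `0, …, n - 1`, edge list `L`, and a
subgraph with edge list `W`: array `0` holds `n` and the lengths of both lists, arrays `1` and `2`
hold the first and second ends of the edges in `L`, arrays `3` and `4` those of the edges in `W`;
all other cells are zero. -/
def inputState (n : ℕ) (L W : List (Fin n × Fin n)) : RealRAM.State where
  nat a i :=
    match a with
    | 0 => [n, L.length, W.length].getD i 0
    | 1 => (L.map fun e => (e.1 : ℕ)).getD i 0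
    | 2 => (L.map fun e => (e.2 : ℕ)).getD i 0
    | 3 => (W.map fun e => (e.1 : ℕ)).getD i 0
    | 4 => (W.map fun e => (e.2 : ℕ)).getD i 0
    | _ => 0
  real _ _ := 0

/-- The computed drawing: the coordinates of vertex `v` are in cell `v` of the real arrays `0`
and `1`. -/
noncomputable def outputDrawing (n : ℕ) (s : RealRAM.State) : Fin n → Plane :=
  fun v => !₂[s.real 0 v, s.real 1 v]

/-! ## Separation by affine functions -/

/-! The plan is to place all vertices in the second quadrant so that each edge of `S` is isolated by
a line, whatever the other edges of `G` are. A quarter circle of radius `R` is cut into `2 * n + 2`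
equal angular slots of width `δ`. Along the spine, a spine vertex `u` with `c` leaves receives a
block of `2 * M` slots, where `M = c + 1`. It sits on the circle in the first slot `a` of its block;
its leaves use slots `a + M + j` with `j < c`, and the next spine vertex is at `a + 2 * M`.

The leaves of `u` lie on a circle of the pencil spanned by the spine circle and the chord from slot
`a - 1` to slot `a + 2 * M`. Every vertex outside the block is inside or on the spine circle and on
the inner side of that chord, so its power with respect to the leaf circle is at most `0`. The
leaves of `u` have power `0`, and `u` has power `4 * R ^ 2` by the choice of the weight in the
pencil. Hence the tangent to the leaf circle at a leaf has that leaf on it, `u` strictly on one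
side, and all other vertices strictly on the other. An edge of `G` not incident to `u` therefore
cannot cross the leaf edge.

The same weight keeps the leaves strictly inside the chord joining `u` to the next spine vertex
(`leafRadius_mul_cos_lt`), so spine edges lie on supporting lines of the vertex set. They also lie
strictly outside the chord from `a - 1` to `a + 2 * M` (`lt_leafRadius_mul`). These two facts, with
the tangents, show that no edge leaving `u` overlaps a leaf edge of `u`. Polar radii exceed `R / 2`
and angles differ by at least `δ`, so `R = 4 * (n + 1)` gives unit distances with area `O(n ^ 2)`.

The computation needs neither sorting nor adjacency lists. Passes over the edge list of `S` compute,
for each vertex, its degree, the number of its spine neighbours and the sum of their names. For a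
leaf this sum names its parent; along the spine, subtracting the previous vertex from it gives the
next one. -/

/-- A real function on the plane that is affine in the coordinates. -/
def IsAffineFn (f : Plane → ℝ) : Prop := ∃ a b c : ℝ, ∀ p : Plane, f p = a * p 0 + b * p 1 + c

theorem IsAffineFn.apply_combo {f : Plane → ℝ} (hf : IsAffineFn f) {s t : ℝ} (h : s + t = 1)
    (x y : Plane) : f (s • x + t • y) = s * f x + t * f y := by
  obtain ⟨a, b, c, hf⟩ := hf
  simp only [hf, PiLp.add_apply, PiLp.smul_apply, smul_eq_mul]
  linear_combination (-c) * h

theorem combo_neg {s t x y : ℝ} (hs : 0 ≤ s) (ht : 0 ≤ t) (h : s + t = 1) (hx : x < 0)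
    (hy : y < 0) : s * x + t * y < 0 := by
  rcases hs.eq_or_lt with rfl | hs
  · have : t = 1 := by linarith
    subst this
    linarith
  · have := mul_neg_of_pos_of_neg hs hx
    have := mul_nonpos_of_nonneg_of_nonpos ht hy.le
    linarith

/-- Drawings in which the edges of `S` are separated from all other edges by lines. -/
theorem isCompatibleDrawing_of_separation {V : Type*} {G S : SimpleGraph V} {pos : V → Plane}
    (spine : V → Prop) (par : V → V) (hinj : Function.Injective pos)
    (hspine : ∀ v, spine v → ∃ f, IsAffineFn f ∧ f (pos v) = 0 ∧ ∀ q, q ≠ v → f (pos q) < 0)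
    (hleaf : ∀ v, ¬ spine v → ∃ f, IsAffineFn f ∧ f (pos v) = 0 ∧ 0 < f (pos (par v)) ∧
      ∀ q, q ≠ v → q ≠ par v → f (pos q) < 0)
    (hray : ∀ v, ¬ spine v → ∀ q, q ≠ v → q ≠ par v →
      pos v ∉ segment ℝ (pos (par v)) (pos q))
    (hedge : ∀ a b, S.Adj a b → (¬ spine a ∧ b = par a) ∨ (¬ spine b ∧ a = par b) ∨
      ∃ f, IsAffineFn f ∧ f (pos a) = 0 ∧ f (pos b) = 0 ∧
        ∀ q, q ≠ a → q ≠ b → f (pos q) < 0) :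
    IsCompatibleDrawing G S pos := by
  -- If neither `c` nor `d` is `u`, then `f ≥ 0` on the leaf edge while `f < 0` on `[c, d]` except
  -- possibly at `v`. Only edges incident to `u` need `hray`.
  have leaf_case : ∀ v u c d, ¬ spine v → u = par v → c ≠ d → s(v, u) ≠ s(c, d) →
      ∀ p ∈ segment ℝ (pos v) (pos u), p ∈ segment ℝ (pos c) (pos d) →
      ∃ w : V, w ∈ s(v, u) ∧ w ∈ s(c, d) ∧ p = pos w := by
    intro v u c d hv hu hcd hne p hp hp'
    obtain ⟨f, hf, fv, fu, fq⟩ := hleaf v hv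
    rw [← hu] at fu fq
    -- the case where `c` is the parent `u`
    have key : ∀ d, d ≠ v → d ≠ u → p ∈ segment ℝ (pos u) (pos d) → p = pos u := by
      intro d hdv hdu hp'
      obtain ⟨s, t, hs, ht, hst, rfl⟩ := hp
      obtain ⟨s', t', hs', ht', hst', he⟩ := hp'
      have hd := fq d hdv hdu
      have e := congrArg f he
      rw [hf.apply_combo hst, hf.apply_combo hst', fv] at e
      rcases hs.eq_or_lt with hs0 | hs0
      · subst hs0
        have : t = 1 := by linarith
        subst this
        simp
      · exfalso
        -- A common point other than `u` makes `v` and `d` lie on one ray from `u`. Solving for `v`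
        -- gives the ratio `t' / s`; it is at most `1` because `f` is positive at `u` and negative
        -- at `d`.
        refine hray v hv d hdv (hu ▸ hdu) ?_
        rw [← hu]
        refine ⟨1 - t' / s, t' / s, ?_, by positivity, by ring, ?_⟩
        · have : t' ≤ s := by nlinarith
          rw [sub_nonneg, div_le_one hs0]
          exact this
        · have e1 : s • pos v = t' • pos d + (s' - t) • pos u := by
            rw [sub_smul, ← sub_eq_zero]
            rw [← sub_eq_zero] at he
            rw [← neg_eq_zero, ← he]
            module
          have e2 : pos v = (1 / s) • (s • pos v) := by
            rw [smul_smul, one_div, inv_mul_cancel₀ hs0.ne', one_smul]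
          rw [e2, e1, smul_add, smul_smul, smul_smul]
          have c1 : 1 / s * (s' - t) = 1 - t' / s := by field_simp; linarith
          have c2 : 1 / s * t' = t' / s := by ring
          rw [c1, c2, add_comm]
    by_cases hcu : c = u
    · subst hcu
      have hdv : d ≠ v := by
        rintro rfl
        exact hne Sym2.eq_swap
      exact ⟨c, by simp, by simp, key d hdv hcd.symm hp'⟩
    by_cases hdu : d = u
    · subst hdu
      have hcv : c ≠ v := by
        rintro rfl
        exact hne rfl
      exact ⟨d, by simp, by simp, key c hcv hcu (segment_symm ℝ (pos c) (pos d) ▸ hp')⟩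
    have main : 0 ≤ f p := by
      obtain ⟨s, t, hs, ht, hst, rfl⟩ := hp
      rw [hf.apply_combo hst, fv]
      positivity
    obtain ⟨s, t, hs, ht, hst, rfl⟩ := hp'
    rw [hf.apply_combo hst] at main
    by_cases hcv : c = v
    · subst hcv
      have hd := fq d hcd.symm hdu
      have : t = 0 := by nlinarith
      subst this
      have : s = 1 := by linarith
      subst this
      exact ⟨c, by simp, by simp, by simp⟩
    by_cases hdv : d = v
    · subst hdv
      have hd := fq c hcv hcu
      have : s = 0 := by nlinarith
      subst this
      have : t = 1 := by linarith
      subst this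
      exact ⟨d, by simp, by simp, by simp⟩
    have h1 := fq c hcv hcu
    have h2 := fq d hdv hdu
    linarith [combo_neg hs ht hst h1 h2]
  refine ⟨⟨hinj, ?_⟩, ?_⟩
  · rintro a b v - hva hvb ⟨s, t, hs, ht, hst, he⟩
    by_cases hv : spine v
    · obtain ⟨f, hf, fv, fq⟩ := hspine v hv
      have e := congrArg f he
      rw [hf.apply_combo hst, fv] at e
      have h1 := fq a hva.symm
      have h2 := fq b hvb.symm
      linarith [combo_neg hs ht hst h1 h2]
    · obtain ⟨f, hf, fv, fu, fq⟩ := hleaf v hv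
      have e := congrArg f he
      rw [hf.apply_combo hst, fv] at e
      by_cases ha : a = par v
      · by_cases hb : b = par v
        · rw [ha, hb] at e
          nlinarith
        · exact hray v hv b hvb.symm hb ⟨s, t, hs, ht, hst, by rw [← ha]; exact he⟩
      · by_cases hb : b = par v
        · exact hray v hv a hva.symm ha
            ⟨t, s, ht, hs, by linarith, by rw [← hb, add_comm]; exact he⟩
        · have h1 := fq a hva.symm ha
          have h2 := fq b hvb.symm hb
          linarith [combo_neg hs ht hst h1 h2]
  · intro a b c d hab hcd hne p hp hp'
    rcases hedge a b hab with ⟨ha, hb⟩ | ⟨hb, ha⟩ | ⟨f, hf, fa, fb, fq⟩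
    · exact leaf_case a b c d ha hb hcd.ne hne p hp hp'
    · rw [segment_symm] at hp
      rw [Sym2.eq_swap] at hne ⊢
      exact leaf_case b a c d hb ha hcd.ne hne p hp hp'
    · have fp : f p = 0 := by
        obtain ⟨s, t, hs, ht, hst, rfl⟩ := hp
        rw [hf.apply_combo hst, fa, fb]
        ring
      -- The line through `a` and `b` supports the vertex set, so another edge can meet it only at
      -- an end belonging to `{a, b}`, and at most one of its ends does.
      have hle : ∀ q, q ∉ s(a, b) → f (pos q) < 0 := by
        intro q hq
        simp only [Sym2.mem_iff, not_or] at hq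
        exact fq q hq.1 hq.2
      obtain ⟨s, t, hs, ht, hst, rfl⟩ := hp'
      rw [hf.apply_combo hst] at fp
      by_cases hc : c ∈ s(a, b)
      · have hd : d ∉ s(a, b) := fun hd => hne ((Sym2.mem_and_mem_iff hcd.ne).1 ⟨hc, hd⟩)
        have h1 := hle d hd
        have h2 : f (pos c) = 0 := by
          rcases Sym2.mem_iff.1 hc with rfl | rfl <;> assumption
        rw [h2] at fp
        have : t = 0 := by nlinarith
        subst this
        have : s = 1 := by linarith
        subst this
        exact ⟨c, hc, by simp, by simp⟩
      · have h1 := hle c hc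
        by_cases hd : d ∈ s(a, b)
        · have h2 : f (pos d) = 0 := by
            rcases Sym2.mem_iff.1 hd with rfl | rfl <;> assumption
          rw [h2] at fp
          have : s = 0 := by nlinarith
          subst this
          have : t = 1 := by linarith
          subst this
          exact ⟨d, hd, by simp, by simp⟩
        · have h2 := hle d hd
          linarith [combo_neg hs ht hst h1 h2]

/-! ## Polar coordinates -/

/-- The point of the second quadrant with polar radius `r` and angle `θ`, measured clockwise from
the negative first axis. -/
noncomputable def polarPoint (r θ : ℝ) : Plane := !₂[-(r * Real.cos θ), r * Real.sin θ]

@[simp] theorem polarPoint_zero (r θ : ℝ) : polarPoint r θ 0 = -(r * Real.cos θ) := rfl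

@[simp] theorem polarPoint_one (r θ : ℝ) : polarPoint r θ 1 = r * Real.sin θ := rfl

theorem dist_sq_eq_coord (p q : Plane) : dist p q ^ 2 = (p 0 - q 0) ^ 2 + (p 1 - q 1) ^ 2 := by
  rw [EuclideanSpace.dist_eq, Real.sq_sqrt (by positivity), Fin.sum_univ_two, Real.dist_eq,
    Real.dist_eq, sq_abs, sq_abs]

theorem dist_sq_polarPoint (r s θ η : ℝ) : dist (polarPoint r θ) (polarPoint s η) ^ 2 =
    r ^ 2 + s ^ 2 - 2 * r * s * Real.cos (θ - η) := by
  rw [dist_sq_eq_coord, Real.cos_sub]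
  simp only [polarPoint_zero, polarPoint_one]
  have h1 := Real.sin_sq_add_cos_sq θ
  have h2 := Real.sin_sq_add_cos_sq η
  linear_combination r ^ 2 * h1 + s ^ 2 * h2

theorem dist_polarPoint_zero (r θ : ℝ) : dist (polarPoint r θ) 0 = |r| := by
  have h : dist (polarPoint r θ) 0 ^ 2 = r ^ 2 := by
    rw [dist_sq_eq_coord]
    simp only [polarPoint_zero, polarPoint_one, PiLp.zero_apply]
    linear_combination r ^ 2 * Real.sin_sq_add_cos_sq θ
  rw [← abs_of_nonneg (dist_nonneg (x := polarPoint r θ) (y := 0)), ← sq_eq_sq_iff_abs_eq_abs]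
  exact h

/-- Two points whose polar radii are at least `a` and whose angles differ by at least `δ`. -/
theorem le_dist_polarPoint {r s θ η δ a : ℝ} (ha : 0 ≤ a) (hr : a ≤ r) (hδ : 0 ≤ δ)
    (h : δ ≤ |θ - η|) (h' : |θ - η| ≤ Real.pi / 2) :
    a * Real.sin δ ≤ dist (polarPoint r θ) (polarPoint s η) := by
  have hpi := Real.pi_pos
  have h1 : Real.sin δ ≤ Real.sin |θ - η| :=
    Real.sin_le_sin_of_le_of_le_pi_div_two (by linarith) h' h
  have h0 : 0 ≤ Real.sin δ := Real.sin_nonneg_of_nonneg_of_le_pi hδ (by linarith)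
  have h2 : a * Real.sin δ ≤ r * Real.sin |θ - η| := mul_le_mul hr h1 h0 (by linarith)
  -- `r * sin |θ - η|` is the distance from the first point to the line through the origin and the
  -- second point.
  refine h2.trans (abs_le_of_sq_le_sq' ?_ dist_nonneg).2
  rw [dist_sq_polarPoint, ← Real.cos_abs (θ - η)]
  have h3 := Real.sin_sq_add_cos_sq |θ - η|
  nlinarith [sq_nonneg (s - r * Real.cos |θ - η|)]

/-- The signed distance of a point from the chord of the circle of radius `R` around the origin
whose midpoint has angle `y * δ` and whose half-width is the angle `h * δ`; it is positive on the
outer side. -/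
noncomputable def chordFn (R δ y h : ℝ) (p : Plane) : ℝ :=
  -Real.cos (y * δ) * p 0 + Real.sin (y * δ) * p 1 + -(R * Real.cos (h * δ))

theorem isAffineFn_chordFn (R δ y h : ℝ) : IsAffineFn (chordFn R δ y h) :=
  ⟨_, _, _, fun _ => rfl⟩

theorem chordFn_polarPoint (R δ y h ρ x : ℝ) : chordFn R δ y h (polarPoint (R * ρ) (x * δ)) =
    R * (ρ * Real.cos ((x - y) * δ) - Real.cos (h * δ)) := by
  simp only [chordFn, polarPoint_zero, polarPoint_one, sub_mul, Real.cos_sub]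
  ring

theorem cos_mul_le_cos_mul {δ x h : ℝ} (hδ : 0 < δ) (h0 : 0 ≤ h) (hx : h ≤ |x|)
    (hx' : |x| * δ ≤ Real.pi / 2) : Real.cos (x * δ) ≤ Real.cos (h * δ) := by
  have : |x * δ| = |x| * δ := by rw [abs_mul, abs_of_pos hδ]
  rw [← Real.cos_abs (x * δ), this]
  exact Real.cos_le_cos_of_nonneg_of_le_pi (by positivity) (by linarith [Real.pi_pos])
    (mul_le_mul_of_nonneg_right hx hδ.le)

theorem cos_mul_lt_cos_mul {δ x h : ℝ} (hδ : 0 < δ) (h0 : 0 ≤ h) (hx : h < |x|)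
    (hx' : |x| * δ ≤ Real.pi / 2) : Real.cos (x * δ) < Real.cos (h * δ) := by
  have : |x * δ| = |x| * δ := by rw [abs_mul, abs_of_pos hδ]
  rw [← Real.cos_abs (x * δ), this]
  exact Real.cos_lt_cos_of_nonneg_of_le_pi (by positivity) (by linarith [Real.pi_pos])
    (mul_lt_mul_of_pos_right hx hδ)

theorem cos_mul_nonneg {δ x : ℝ} (hδ : 0 < δ) (hx' : |x| * δ ≤ Real.pi / 2) :
    0 ≤ Real.cos (x * δ) := by
  have : |x * δ| = |x| * δ := by rw [abs_mul, abs_of_pos hδ]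
  rw [← Real.cos_abs (x * δ), this]
  exact Real.cos_nonneg_of_neg_pi_div_two_le_of_le
    (by linarith [Real.pi_pos, mul_nonneg (abs_nonneg x) hδ.le]) hx'

/-- Within a right angle the cosine is nonnegative, so decreasing the polar radius from `1` only
moves a point further inward from the chord. -/
theorem mul_cos_mul_le {δ x h ρ : ℝ} (hδ : 0 < δ) (h0 : 0 ≤ h) (hx : h ≤ |x|)
    (hx' : |x| * δ ≤ Real.pi / 2) (hρ : ρ ≤ 1) :
    ρ * Real.cos (x * δ) ≤ Real.cos (h * δ) :=
  (mul_le_of_le_one_left (cos_mul_nonneg hδ hx') hρ).trans (cos_mul_le_cos_mul hδ h0 hx hx')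

theorem mul_cos_mul_lt {δ x h ρ : ℝ} (hδ : 0 < δ) (h0 : 0 ≤ h) (hx : h < |x|)
    (hx' : |x| * δ ≤ Real.pi / 2) (hρ : ρ ≤ 1) :
    ρ * Real.cos (x * δ) < Real.cos (h * δ) :=
  (mul_le_of_le_one_left (cos_mul_nonneg hδ hx') hρ).trans_lt (cos_mul_lt_cos_mul hδ h0 hx hx')

/-! ## The polar radii of the leaves -/

/-- The weight of the chord in the equation of the circle through the leaves of a spine vertex. -/
noncomputable def leafWeight (δ M : ℝ) : ℝ := 2 / (Real.sin (M * δ) * Real.sin (δ / 2))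

/-- The polar radius, relative to the radius of the circle of the spine, of the `j`-th of `M - 1`
leaves of a spine vertex. -/
noncomputable def leafRadius (δ M j : ℝ) : ℝ :=
  (Real.sqrt ((leafWeight δ M * Real.cos ((j + 1 / 2) * δ)) ^ 2 +
    4 * (1 + leafWeight δ M * Real.cos ((M + 1 / 2) * δ))) -
    leafWeight δ M * Real.cos ((j + 1 / 2) * δ)) / 2

section LeafRadius

variable {δ M j : ℝ}

theorem leafWeight_pos (hδ : 0 < δ) (hM : 1 ≤ M) (hMδ : (M + 1 / 2) * δ ≤ Real.pi / 4) :
    0 < leafWeight δ M := by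
  have hpi := Real.pi_pos
  have h1 : 0 < Real.sin (M * δ) := Real.sin_pos_of_pos_of_lt_pi (by positivity) (by nlinarith)
  have h2 : 0 < Real.sin (δ / 2) := Real.sin_pos_of_pos_of_lt_pi (by positivity) (by nlinarith)
  unfold leafWeight
  positivity

/-- The difference of cosines is `2 * sin (M * δ) * sin (δ / 2)`, the reciprocal of the weight up to
the factor `4`. This normalization becomes the power of the spine vertex with respect to its leaf
circle. -/
theorem leafWeight_mul (hδ : 0 < δ) (hM : 1 ≤ M) (hMδ : (M + 1 / 2) * δ ≤ Real.pi / 4) :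
    leafWeight δ M * (Real.cos ((M - 1 / 2) * δ) - Real.cos ((M + 1 / 2) * δ)) = 4 := by
  have hpi := Real.pi_pos
  have h1 : 0 < Real.sin (M * δ) := Real.sin_pos_of_pos_of_lt_pi (by positivity) (by nlinarith)
  have h2 : 0 < Real.sin (δ / 2) := Real.sin_pos_of_pos_of_lt_pi (by positivity) (by nlinarith)
  have e1 : (M - 1 / 2) * δ = M * δ - δ / 2 := by ring
  have e2 : (M + 1 / 2) * δ = M * δ + δ / 2 := by ring
  rw [e1, e2, Real.cos_sub, Real.cos_add, leafWeight]
  field_simp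
  ring

theorem cos_half_pos (hMδ : (M + 1 / 2) * δ ≤ Real.pi / 4) (h0 : 0 ≤ (M + 1 / 2) * δ) :
    1 / 2 < Real.cos ((M + 1 / 2) * δ) := by
  have hpi := Real.pi_pos
  have h := Real.cos_lt_cos_of_nonneg_of_le_pi h0 (show Real.pi / 3 ≤ Real.pi by linarith)
    (by linarith)
  rwa [Real.cos_pi_div_three] at h

/-- `leafRadius` is the positive root of this quadratic, which is the equation of the leaf circle
restricted to the ray of the `j`-th leaf. The offset `j + 1 / 2` is measured from the middle of the
chord of half-width `M + 1 / 2`. -/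
theorem leafRadius_eq (hδ : 0 < δ) (hM : 1 ≤ M) (hMδ : (M + 1 / 2) * δ ≤ Real.pi / 4) :
    leafRadius δ M j ^ 2 - 1 + leafWeight δ M *
      (leafRadius δ M j * Real.cos ((j + 1 / 2) * δ) - Real.cos ((M + 1 / 2) * δ)) = 0 := by
  have hw := leafWeight_pos hδ hM hMδ
  have hc := cos_half_pos hMδ (by positivity)
  have hc0 : 0 < Real.cos ((M + 1 / 2) * δ) := by linarith
  have hs := Real.sq_sqrt (show 0 ≤ (leafWeight δ M * Real.cos ((j + 1 / 2) * δ)) ^ 2 +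
    4 * (1 + leafWeight δ M * Real.cos ((M + 1 / 2) * δ)) by positivity)
  unfold leafRadius
  linear_combination (1 / 4) * hs

theorem leafRadius_pos (hδ : 0 < δ) (hM : 1 ≤ M) (hMδ : (M + 1 / 2) * δ ≤ Real.pi / 4) :
    0 < leafRadius δ M j := by
  have hw := leafWeight_pos hδ hM hMδ
  have hc := cos_half_pos hMδ (by positivity)
  have h := mul_pos hw (show 0 < Real.cos ((M + 1 / 2) * δ) by linarith)
  unfold leafRadius
  refine div_pos (sub_pos.2 ?_) two_pos
  refine Real.lt_sqrt_of_sq_lt ?_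
  linarith

/-- At radius at least `1` a point in this angular range is strictly outside the chord and not
inside the circle, so the left side of `leafRadius_eq` would be positive. -/
theorem leafRadius_lt_one (hδ : 0 < δ) (hM : 1 ≤ M) (hMδ : (M + 1 / 2) * δ ≤ Real.pi / 4)
    (hj : 0 ≤ j) (hjM : j + 1 ≤ M) : leafRadius δ M j < 1 := by
  have hpi := Real.pi_pos
  have hw := leafWeight_pos hδ hM hMδ
  have hr := leafRadius_pos (j := j) hδ hM hMδ
  have he := leafRadius_eq (j := j) hδ hM hMδ
  have hc := cos_half_pos hMδ (by positivity)
  have hlt : Real.cos ((M + 1 / 2) * δ) < Real.cos ((j + 1 / 2) * δ) :=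
    Real.cos_lt_cos_of_nonneg_of_le_pi (by positivity) (by linarith)
      (mul_lt_mul_of_pos_right (by linarith) hδ)
  by_contra h
  push Not at h
  have h1 : Real.cos ((j + 1 / 2) * δ) ≤ leafRadius δ M j * Real.cos ((j + 1 / 2) * δ) :=
    le_mul_of_one_le_left (by linarith) h
  have h2 := mul_pos hw (show 0 < leafRadius δ M j * Real.cos ((j + 1 / 2) * δ) -
    Real.cos ((M + 1 / 2) * δ) by linarith)
  nlinarith

/-- In `leafRadius_eq` the circle term is negative, so the chord term must be positive. -/
theorem lt_leafRadius_mul (hδ : 0 < δ) (hM : 1 ≤ M) (hMδ : (M + 1 / 2) * δ ≤ Real.pi / 4)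
    (hj : 0 ≤ j) (hjM : j + 1 ≤ M) :
    Real.cos ((M + 1 / 2) * δ) < leafRadius δ M j * Real.cos ((j + 1 / 2) * δ) := by
  have hw := leafWeight_pos hδ hM hMδ
  have hr := leafRadius_pos (j := j) hδ hM hMδ
  have he := leafRadius_eq (j := j) hδ hM hMδ
  have hl := leafRadius_lt_one hδ hM hMδ hj hjM
  by_contra h
  push Not at h
  have h2 := mul_nonneg hw.le (sub_nonneg.2 h)
  nlinarith

theorem half_lt_leafRadius (hδ : 0 < δ) (hM : 1 ≤ M) (hMδ : (M + 1 / 2) * δ ≤ Real.pi / 4)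
    (hj : 0 ≤ j) (hjM : j + 1 ≤ M) : 1 / 2 < leafRadius δ M j := by
  have h1 := lt_leafRadius_mul hδ hM hMδ hj hjM
  have h2 := cos_half_pos hMδ (by positivity)
  have h3 := mul_le_of_le_one_right (leafRadius_pos (j := j) hδ hM hMδ).le
    (Real.cos_le_one ((j + 1 / 2) * δ))
  linarith

/-- The leaves must stay inside the chord between consecutive spine vertices. Where the ray of the
leaf meets this chord, the quadratic of `leafRadius_eq` has the sign of `2 * cos (j * δ) - sin (M *
δ) * sin ((M + j) * δ)`. This is positive since `cos (j * δ) > 1 / 2`, so the root comes earlier on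
the ray. This bound requires the weight to be large. -/
theorem leafRadius_mul_cos_lt (hδ : 0 < δ) (hM : 1 ≤ M) (hMδ : (M + 1 / 2) * δ ≤ Real.pi / 4)
    (hj : 0 ≤ j) (hjM : j + 1 ≤ M) :
    leafRadius δ M j * Real.cos (j * δ) < Real.cos (M * δ) := by
  have hpi := Real.pi_pos
  have hw := leafWeight_pos hδ hM hMδ
  have hr := leafRadius_pos (j := j) hδ hM hMδ
  have he := leafRadius_eq (j := j) hδ hM hMδ
  have h1 : 0 < Real.sin (M * δ) := Real.sin_pos_of_pos_of_lt_pi (by positivity) (by nlinarith)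
  have h2 : 0 < Real.sin (δ / 2) := Real.sin_pos_of_pos_of_lt_pi (by positivity) (by nlinarith)
  have hMj : 0 < Real.sin ((M - j) * δ) :=
    Real.sin_pos_of_pos_of_lt_pi (mul_pos (by linarith) hδ) (by nlinarith)
  have hcj : 1 / 2 < Real.cos (j * δ) := by
    rw [← Real.cos_pi_div_three]
    exact Real.cos_lt_cos_of_nonneg_of_le_pi (by positivity) (by linarith) (by nlinarith)
  have hcM : 0 < Real.cos (M * δ) :=
    Real.cos_pos_of_mem_Ioo ⟨by nlinarith, by nlinarith⟩
  have hch : 0 < Real.cos ((j + 1 / 2) * δ) :=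
    Real.cos_pos_of_mem_Ioo ⟨by nlinarith, by nlinarith⟩
  by_contra h
  push Not at h
  -- the point of the chord at the same angle
  set r := Real.cos (M * δ) / Real.cos (j * δ) with hrdef
  have hcj0 : 0 < Real.cos (j * δ) := by linarith
  have hr0 : 0 < r := by positivity
  have hrle : r ≤ leafRadius δ M j := by
    rw [hrdef, div_le_iff₀ hcj0]
    exact h
  have hrc : r * Real.cos (j * δ) = Real.cos (M * δ) := by
    rw [hrdef, div_mul_cancel₀ _ hcj0.ne']
  -- The quadratic increases for positive arguments and vanishes at `leafRadius`, so it is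
  -- nonpositive at `r`.
  have hmono : r ^ 2 - 1 + leafWeight δ M *
      (r * Real.cos ((j + 1 / 2) * δ) - Real.cos ((M + 1 / 2) * δ)) ≤ 0 := by
    have a1 : r ^ 2 ≤ leafRadius δ M j ^ 2 := pow_le_pow_left₀ hr0.le hrle 2
    have a2 := mul_le_mul_of_nonneg_left (mul_le_mul_of_nonneg_right hrle hch.le) hw.le
    nlinarith
  have e1 : Real.cos (j * δ) * (r * Real.cos ((j + 1 / 2) * δ) - Real.cos ((M + 1 / 2) * δ)) =
      Real.sin (δ / 2) * Real.sin ((M - j) * δ) := by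
    have : Real.cos (j * δ) * (r * Real.cos ((j + 1 / 2) * δ) - Real.cos ((M + 1 / 2) * δ)) =
        Real.cos (M * δ) * Real.cos ((j + 1 / 2) * δ) -
          Real.cos (j * δ) * Real.cos ((M + 1 / 2) * δ) := by
      rw [← hrc]
      ring
    rw [this, show (j + 1 / 2) * δ = j * δ + δ / 2 by ring,
      show (M + 1 / 2) * δ = M * δ + δ / 2 by ring, show (M - j) * δ = M * δ - j * δ by ring,
      Real.cos_add, Real.cos_add, Real.sin_sub]
    ring
  have e2 : Real.cos (j * δ) ^ 2 * (r ^ 2 - 1) =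
      -(Real.sin ((M - j) * δ) * Real.sin ((M + j) * δ)) := by
    rw [show (M - j) * δ = M * δ - j * δ by ring, show (M + j) * δ = M * δ + j * δ by ring,
      Real.sin_sub, Real.sin_add]
    have a1 := Real.sin_sq_add_cos_sq (M * δ)
    have a2 := Real.sin_sq_add_cos_sq (j * δ)
    have : Real.cos (j * δ) ^ 2 * (r ^ 2 - 1) =
      Real.cos (M * δ) ^ 2 - Real.cos (j * δ) ^ 2 := by
      rw [← hrc]
      ring
    rw [this]
    linear_combination (Real.cos (j * δ) ^ 2) * a1 - (Real.cos (M * δ) ^ 2) * a2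
  have e3 : Real.sin (M * δ) * (leafWeight δ M * Real.sin (δ / 2)) = 2 := by
    unfold leafWeight
    field_simp
  -- Multiplying by `sin (M * δ) * cos (j * δ) ^ 2` clears the denominators of `r` and of the
  -- weight; `e4` then factors the result.
  have key := mul_nonpos_of_nonneg_of_nonpos
    (mul_pos h1 (pow_pos hcj0 2)).le hmono
  have e4 : Real.sin (M * δ) * Real.cos (j * δ) ^ 2 * (r ^ 2 - 1 + leafWeight δ M *
      (r * Real.cos ((j + 1 / 2) * δ) - Real.cos ((M + 1 / 2) * δ))) =
      Real.sin ((M - j) * δ) *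
        (2 * Real.cos (j * δ) - Real.sin (M * δ) * Real.sin ((M + j) * δ)) := by
    linear_combination Real.sin (M * δ) * e2 +
      Real.sin (M * δ) * leafWeight δ M * Real.cos (j * δ) * e1 +
      Real.cos (j * δ) * Real.sin ((M - j) * δ) * e3
  rw [e4] at key
  have h5 : Real.sin (M * δ) * Real.sin ((M + j) * δ) ≤ 1 := by
    have b1 := Real.sin_le_one (M * δ)
    have b2 := Real.sin_le_one ((M + j) * δ)
    nlinarith
  have := mul_pos hMj (show 0 < 2 * Real.cos (j * δ) -
    Real.sin (M * δ) * Real.sin ((M + j) * δ) by linarith)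
  linarith

end LeafRadius

/-! ## Block layouts -/

/-- The spine vertices occupy disjoint blocks of slots; the leaves of a spine vertex use slots in
the second half of its block. -/
structure BlockLayout (V : Type*) where
  /-- The number of vertices. -/
  n : ℕ
  /-- The vertices treated as spine vertices. -/
  spine : V → Prop
  /-- The spine vertex adjacent to a leaf. -/
  par : V → V
  /-- The first slot of the block of a spine vertex. -/
  start : V → ℕ
  /-- Half the length of the block of a spine vertex. -/
  half : V → ℕ
  /-- The position of a leaf among the leaves of the same spine vertex. -/
  idx : V → ℕ
  half_pos : ∀ v, 1 ≤ half v
  half_le : ∀ v, half v ≤ n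
  start_pos : ∀ v, spine v → 1 ≤ start v
  start_le : ∀ v, spine v → start v + 2 * half v ≤ 2 * n + 1
  disjoint : ∀ u v, spine u → spine v → u ≠ v →
    start u + 2 * half u ≤ start v ∨ start v + 2 * half v ≤ start u
  spine_par : ∀ v, ¬ spine v → spine (par v)
  idx_lt : ∀ v, ¬ spine v → idx v + 1 < half (par v)
  idx_inj : ∀ u v, ¬ spine u → ¬ spine v → par u = par v → idx u = idx v → u = v

namespace BlockLayout

variable {V : Type*} (l : BlockLayout V)

/-- The angle of a slot. -/
noncomputable def unit : ℝ := Real.pi / (4 * (l.n + 1))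

/-- The radius of the circle of the spine. -/
noncomputable def radius : ℝ := 4 * (l.n + 1)

open Classical in
/-- The slot of a vertex. -/
noncomputable def slot (v : V) : ℕ :=
  if l.spine v then l.start v else l.start (l.par v) + l.half (l.par v) + l.idx v

open Classical in
/-- The relative polar radius of a vertex. -/
noncomputable def rad (v : V) : ℝ :=
  if l.spine v then 1 else leafRadius l.unit (l.half (l.par v)) (l.idx v)

/-- The drawing of a block layout. -/
noncomputable def pos (v : V) : Plane := polarPoint (l.radius * l.rad v) (l.slot v * l.unit)

open Classical in
/-- The spine vertex whose block contains the vertex. -/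
noncomputable def owner (v : V) : V := if l.spine v then v else l.par v

variable {l} {u v q : V}

/-! ### Arithmetic of slots and blocks -/

theorem slot_of_spine (h : l.spine v) : l.slot v = l.start v := if_pos h

theorem slot_of_not_spine (h : ¬ l.spine v) :
    l.slot v = l.start (l.par v) + l.half (l.par v) + l.idx v := if_neg h

theorem rad_of_spine (h : l.spine v) : l.rad v = 1 := if_pos h

theorem rad_of_not_spine (h : ¬ l.spine v) :
    l.rad v = leafRadius l.unit (l.half (l.par v)) (l.idx v) := if_neg h

theorem owner_of_spine (h : l.spine v) : l.owner v = v := if_pos h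

theorem owner_of_not_spine (h : ¬ l.spine v) : l.owner v = l.par v := if_neg h

theorem unit_pos : 0 < l.unit := by
  have := Real.pi_pos
  unfold unit
  positivity

theorem radius_pos : 0 < l.radius := by
  unfold radius
  positivity

/-- The slots actually occupied lie between `1` and `2 * n - 1`. The spare ones accommodate chords
ending just before or after a block, while all angle differences stay within `π / 2`. -/
theorem unit_mul : (2 * l.n + 2) * l.unit = Real.pi / 2 := by
  unfold unit
  field_simp
  ring

theorem spine_owner (v : V) : l.spine (l.owner v) := by
  by_cases h : l.spine v
  · rwa [owner_of_spine h]
  · rw [owner_of_not_spine h]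
    exact l.spine_par v h

theorem slot_mem (v : V) : l.start (l.owner v) ≤ l.slot v ∧
    l.slot v + 2 ≤ l.start (l.owner v) + 2 * l.half (l.owner v) := by
  by_cases h : l.spine v
  · rw [owner_of_spine h, slot_of_spine h]
    have := l.half_pos v
    omega
  · rw [owner_of_not_spine h, slot_of_not_spine h]
    have := l.idx_lt v h
    omega

/-- The last slot of every block is empty, whence the gap of two before the block of `u`. -/
theorem slot_of_owner_ne (hu : l.spine u) (h : l.owner q ≠ u) :
    l.slot q + 2 ≤ l.start u ∨ l.start u + 2 * l.half u ≤ l.slot q := by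
  have h1 := l.disjoint _ _ (spine_owner q) hu h
  have h2 := slot_mem (l := l) q
  omega

theorem slot_bounds (v : V) : 1 ≤ l.slot v ∧ l.slot v + 1 ≤ 2 * l.n := by
  have h1 := l.start_pos _ (spine_owner v)
  have h2 := l.start_le _ (spine_owner v)
  have h3 := slot_mem (l := l) v
  omega

theorem slot_injective : Function.Injective l.slot := by
  intro u v huv
  by_contra hne
  by_cases ho : l.owner u = l.owner v
  · by_cases hu : l.spine u
    · by_cases hv : l.spine v
      · rw [owner_of_spine hu, owner_of_spine hv] at ho
        exact hne ho
      · rw [owner_of_spine hu, owner_of_not_spine hv] at ho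
        rw [slot_of_spine hu, slot_of_not_spine hv, ← ho] at huv
        have := l.half_pos u
        omega
    · by_cases hv : l.spine v
      · rw [owner_of_not_spine hu, owner_of_spine hv] at ho
        rw [slot_of_not_spine hu, slot_of_spine hv, ho] at huv
        have := l.half_pos v
        omega
      · rw [owner_of_not_spine hu, owner_of_not_spine hv] at ho
        rw [slot_of_not_spine hu, slot_of_not_spine hv, ho] at huv
        exact hne (l.idx_inj u v hu hv ho (by omega))
  · have h1 := slot_of_owner_ne (spine_owner v) ho
    have h2 := slot_mem (l := l) v
    omega

theorem one_le_half (v : V) : (1 : ℝ) ≤ l.half v := by exact_mod_cast l.half_pos v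

theorem half_mul_unit (v : V) : ((l.half v : ℝ) + 1 / 2) * l.unit ≤ Real.pi / 4 := by
  have h1 : (l.half v : ℝ) ≤ l.n := by exact_mod_cast l.half_le v
  have h2 := unit_mul (l := l)
  have h3 := unit_pos (l := l)
  nlinarith

theorem idx_add_one_le (h : ¬ l.spine v) : (l.idx v : ℝ) + 1 ≤ l.half (l.par v) := by
  exact_mod_cast (l.idx_lt v h).le

theorem rad_le_one (v : V) : l.rad v ≤ 1 := by
  by_cases h : l.spine v
  · exact (rad_of_spine h).le
  · rw [rad_of_not_spine h]
    exact (leafRadius_lt_one unit_pos (one_le_half _) (half_mul_unit _) (Nat.cast_nonneg _)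
      (idx_add_one_le h)).le

theorem rad_lt_one (h : ¬ l.spine v) : l.rad v < 1 := by
  rw [rad_of_not_spine h]
  exact leafRadius_lt_one unit_pos (one_le_half _) (half_mul_unit _) (Nat.cast_nonneg _)
    (idx_add_one_le h)

theorem half_lt_rad (v : V) : 1 / 2 < l.rad v := by
  by_cases h : l.spine v
  · rw [rad_of_spine h]
    norm_num
  · rw [rad_of_not_spine h]
    exact half_lt_leafRadius unit_pos (one_le_half _) (half_mul_unit _) (Nat.cast_nonneg _)
      (idx_add_one_le h)

theorem rad_pos (v : V) : 0 < l.rad v := by linarith [half_lt_rad (l := l) v]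

theorem abs_mul_unit_le {x : ℝ} (h1 : -(2 * l.n + 2) ≤ x) (h2 : x ≤ 2 * l.n + 2) :
    |x| * l.unit ≤ Real.pi / 2 := by
  rw [← unit_mul]
  exact mul_le_mul_of_nonneg_right (abs_le.2 ⟨h1, h2⟩) unit_pos.le

/-! ### Sides of chords, and resolution -/

theorem chordFn_pos (y h : ℝ) (v : V) : chordFn l.radius l.unit y h (l.pos v) =
    l.radius * (l.rad v * Real.cos ((l.slot v - y) * l.unit) - Real.cos (h * l.unit)) :=
  chordFn_polarPoint ..

theorem slot_cast_bounds (v : V) : (1 : ℝ) ≤ l.slot v ∧ (l.slot v : ℝ) + 1 ≤ 2 * l.n := by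
  exact_mod_cast slot_bounds (l := l) v

/-- Vertices outside the range of a chord are not on its outer side. -/
theorem chordFn_pos_nonpos {y h : ℝ} (h0 : 0 ≤ h) (hy0 : 0 ≤ y) (hy : y ≤ 2 * l.n + 2)
    (hq : (l.slot q : ℝ) ≤ y - h ∨ y + h ≤ l.slot q) :
    chordFn l.radius l.unit y h (l.pos q) ≤ 0 := by
  rw [chordFn_pos]
  have hs := slot_cast_bounds (l := l) q
  refine mul_nonpos_of_nonneg_of_nonpos radius_pos.le (sub_nonpos.2 ?_)
  refine mul_cos_mul_le unit_pos h0 ?_ (abs_mul_unit_le (by linarith) (by linarith))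
    (rad_le_one q)
  rw [le_abs]
  rcases hq with hq | hq
  · exact Or.inr (by linarith)
  · exact Or.inl (by linarith)

theorem chordFn_pos_neg {y h : ℝ} (h0 : 0 ≤ h) (hy0 : 0 ≤ y) (hy : y ≤ 2 * l.n + 2)
    (hq : (l.slot q : ℝ) < y - h ∨ y + h < l.slot q) :
    chordFn l.radius l.unit y h (l.pos q) < 0 := by
  rw [chordFn_pos]
  have hs := slot_cast_bounds (l := l) q
  refine mul_neg_of_pos_of_neg radius_pos (sub_neg.2 ?_)
  refine mul_cos_mul_lt unit_pos h0 ?_ (abs_mul_unit_le (by linarith) (by linarith))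
    (rad_le_one q)
  rw [lt_abs]
  rcases hq with hq | hq
  · exact Or.inr (by linarith)
  · exact Or.inl (by linarith)

theorem start_cast_bounds (hu : l.spine u) :
    (1 : ℝ) ≤ l.start u ∧ (l.start u : ℝ) + 2 * l.half u ≤ 2 * l.n + 1 := by
  have h1 := l.start_pos u hu
  have h2 := l.start_le u hu
  constructor
  · exact_mod_cast h1
  · exact_mod_cast h2

/-- Distinct slots differ by an angle of at least `unit`, and polar radii exceed half the circle
radius. Since `radius * unit = π`, Jordan's inequality `sin x ≥ 2 * x / π` gives exactly `1`. -/
theorem hasUnitResolution : HasUnitResolution l.pos := by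
  intro u v hne
  have hs : l.slot u ≠ l.slot v := fun h => hne (slot_injective h)
  have h1 := slot_cast_bounds (l := l) u
  have h2 := slot_cast_bounds (l := l) v
  have hpi := Real.pi_pos
  have hδ := unit_pos (l := l)
  have hR := radius_pos (l := l)
  have h3 : 1 ≤ |(l.slot u : ℝ) - l.slot v| := by
    have : (1 : ℤ) ≤ |(l.slot u : ℤ) - l.slot v| := Int.one_le_abs (by omega)
    exact_mod_cast this
  have h4 := abs_mul_unit_le (l := l) (x := (l.slot u : ℝ) - l.slot v) (by linarith) (by linarith)
  have h5 : |(l.slot u : ℝ) * l.unit - l.slot v * l.unit| =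
      |(l.slot u : ℝ) - l.slot v| * l.unit := by
    rw [← sub_mul, abs_mul, abs_of_pos hδ]
  refine le_trans ?_ (le_dist_polarPoint (r := l.radius * l.rad u) (s := l.radius * l.rad v)
    (θ := l.slot u * l.unit) (η := l.slot v * l.unit) (δ := l.unit) (a := l.radius * (1 / 2))
    (by positivity) (mul_le_mul_of_nonneg_left (half_lt_rad u).le hR.le) hδ.le
    (by rw [h5]; exact le_mul_of_one_le_left hδ.le h3) (by rw [h5]; exact h4))
  have h6 : l.unit ≤ Real.pi / 2 := by
    rw [← unit_mul]
    have : (0 : ℝ) ≤ l.n := Nat.cast_nonneg _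
    nlinarith
  have h7 := Real.mul_le_sin hδ.le h6
  have h8 : l.radius * (1 / 2) * (2 / Real.pi * l.unit) = 1 := by
    unfold radius unit
    field_simp
  exact h8.symm.le.trans (mul_le_mul_of_nonneg_left h7 (by positivity))

theorem pos_injective : Function.Injective l.pos := by
  intro u v huv
  by_contra hne
  have := hasUnitResolution (l := l) u v hne
  rw [huv, dist_self] at this
  linarith

/-- The power of a point with respect to the circle through the leaves of `u`. -/
noncomputable def leafPower (l : BlockLayout V) (u : V) (p : Plane) : ℝ :=
  p 0 ^ 2 + p 1 ^ 2 - l.radius ^ 2 + l.radius * leafWeight l.unit (l.half u) *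
    chordFn l.radius l.unit (l.start u + l.half u - 1 / 2) (l.half u + 1 / 2) p

/-! ### The circle through the leaves of a spine vertex -/

theorem pos_sq_add_sq (v : V) : l.pos v 0 ^ 2 + l.pos v 1 ^ 2 = (l.radius * l.rad v) ^ 2 := by
  simp only [pos, polarPoint_zero, polarPoint_one]
  linear_combination (l.radius * l.rad v) ^ 2 * Real.sin_sq_add_cos_sq (l.slot v * l.unit)

theorem leafPower_leaf (h : ¬ l.spine v) : l.leafPower (l.par v) (l.pos v) = 0 := by
  have he := leafRadius_eq (j := l.idx v) (unit_pos (l := l)) (one_le_half (l.par v))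
    (half_mul_unit (l.par v))
  rw [← rad_of_not_spine h] at he
  rw [leafPower, pos_sq_add_sq, chordFn_pos, slot_of_not_spine h]
  push_cast
  rw [show (l.start (l.par v) + l.half (l.par v) + l.idx v -
    (l.start (l.par v) + l.half (l.par v) - 1 / 2) : ℝ) = l.idx v + 1 / 2 by ring]
  linear_combination l.radius ^ 2 * he

theorem leafPower_spine (h : l.spine u) : l.leafPower u (l.pos u) = 4 * l.radius ^ 2 := by
  have he := leafWeight_mul (unit_pos (l := l)) (one_le_half u) (half_mul_unit u)
  rw [leafPower, pos_sq_add_sq, chordFn_pos, slot_of_spine h, rad_of_spine h]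
  rw [show ((l.start u : ℝ) - (l.start u + l.half u - 1 / 2)) * l.unit =
    -((l.half u - 1 / 2) * l.unit) by ring, Real.cos_neg]
  linear_combination l.radius ^ 2 * he

/-- The chord in `leafPower` runs from slot `start u - 1` to slot `start u + 2 * half u`. Vertices
of other blocks have slots outside the open range between these ends, so both the circle term and
the chord term are nonpositive. -/
theorem leafPower_nonpos (hu : l.spine u) (hq : q ≠ u) : l.leafPower u (l.pos q) ≤ 0 := by
  by_cases ho : l.owner q = u
  · by_cases hs : l.spine q
    · rw [owner_of_spine hs] at ho
      exact absurd ho hq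
    · rw [owner_of_not_spine hs] at ho
      rw [← ho]
      exact (leafPower_leaf hs).le
  · rw [leafPower, pos_sq_add_sq]
    have hw := leafWeight_pos (unit_pos (l := l)) (one_le_half u) (half_mul_unit u)
    have hb := start_cast_bounds hu
    have hh := one_le_half (l := l) u
    have hR := radius_pos (l := l)
    have hc : chordFn l.radius l.unit (l.start u + l.half u - 1 / 2) (l.half u + 1 / 2)
        (l.pos q) ≤ 0 := by
      refine chordFn_pos_nonpos (by linarith) (by linarith) (by linarith) ?_
      rcases slot_of_owner_ne hu ho with h | h
      · left
        have : (l.slot q : ℝ) + 2 ≤ l.start u := by exact_mod_cast h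
        linarith
      · right
        have : (l.start u : ℝ) + 2 * l.half u ≤ l.slot q := by exact_mod_cast h
        linarith
    have h1 := mul_nonpos_of_nonneg_of_nonpos (mul_pos hR hw).le hc
    have h2 : (l.radius * l.rad q) ^ 2 ≤ l.radius ^ 2 :=
      pow_le_pow_left₀ (mul_pos hR (rad_pos q)).le
        (mul_le_of_le_one_right hR.le (rad_le_one q)) 2
    linarith

theorem abs_slot_sub_mul_le (u v : V) :
    |(l.slot u : ℝ) - l.slot v| * l.unit ≤ Real.pi / 2 := by
  have h1 := slot_cast_bounds (l := l) u
  have h2 := slot_cast_bounds (l := l) v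
  exact abs_mul_unit_le (by linarith) (by linarith)

/-- All angles differ by at most `π / 2`. The point of the bound is that it is below the power `4 *
radius ^ 2` of a spine vertex. -/
theorem dist_sq_pos_le (u v : V) : dist (l.pos u) (l.pos v) ^ 2 ≤ 2 * l.radius ^ 2 := by
  have hR := radius_pos (l := l)
  have h1 : ∀ v, (l.radius * l.rad v) ^ 2 ≤ l.radius ^ 2 := fun q =>
    pow_le_pow_left₀ (mul_pos hR (rad_pos q)).le (mul_le_of_le_one_right hR.le (rad_le_one q)) 2
  have h2 := cos_mul_nonneg unit_pos (abs_slot_sub_mul_le (l := l) u v)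
  rw [pos, pos, dist_sq_polarPoint, ← sub_mul]
  have h3 : 0 ≤ 2 * (l.radius * l.rad u) * (l.radius * l.rad v) *
      Real.cos ((l.slot u - l.slot v) * l.unit) := by
    have := rad_pos (l := l) u
    have := rad_pos (l := l) v
    positivity
  linarith [h1 u, h1 v]

/-- A leaf is separated from all other vertices but its neighbour by a tangent of the circle of the
leaves. -/
theorem exists_leaf_support (hv : ¬ l.spine v) : ∃ f, IsAffineFn f ∧ f (l.pos v) = 0 ∧
    0 < f (l.pos (l.par v)) ∧ ∀ q, q ≠ v → q ≠ l.par v → f (l.pos q) < 0 := by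
  -- Subtracting the squared distance cancels the quadratic terms. What remains is an affine
  -- function vanishing on the tangent at the leaf, and it inherits the sign of the power, strictly
  -- away from the leaf.
  refine ⟨fun p => l.leafPower (l.par v) p - dist p (l.pos v) ^ 2, ?_, ?_, ?_, ?_⟩
  · refine ⟨2 * l.pos v 0 + l.radius * leafWeight l.unit (l.half (l.par v)) *
      -Real.cos ((l.start (l.par v) + l.half (l.par v) - 1 / 2) * l.unit),
      2 * l.pos v 1 + l.radius * leafWeight l.unit (l.half (l.par v)) *
      Real.sin ((l.start (l.par v) + l.half (l.par v) - 1 / 2) * l.unit),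
      -l.radius ^ 2 - l.pos v 0 ^ 2 - l.pos v 1 ^ 2 +
      l.radius * leafWeight l.unit (l.half (l.par v)) *
      -(l.radius * Real.cos ((l.half (l.par v) + 1 / 2) * l.unit)), fun p => ?_⟩
    simp only [leafPower, dist_sq_eq_coord, chordFn]
    ring
  · simp [leafPower_leaf hv]
  · have h1 := dist_sq_pos_le (l := l) (l.par v) v
    have hR := pow_pos (radius_pos (l := l)) 2
    simp only [leafPower_spine (l.spine_par v hv)]
    linarith
  · intro q hqv hqu
    have h1 := leafPower_nonpos (l.spine_par v hv) hqu
    have h2 : 0 < dist (l.pos q) (l.pos v) := dist_pos.2 fun h => hqv (pos_injective h)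
    have h3 := pow_pos h2 2
    simp only
    linarith

/-! ### Supporting lines at spine vertices and spine edges -/

theorem exists_spine_support (hv : l.spine v) : ∃ f, IsAffineFn f ∧ f (l.pos v) = 0 ∧
    ∀ q, q ≠ v → f (l.pos q) < 0 := by
  have hb := slot_cast_bounds (l := l) v
  -- The chord of width zero is the tangent to the spine circle.
  refine ⟨chordFn l.radius l.unit (l.slot v) 0, isAffineFn_chordFn .., ?_, fun q hq => ?_⟩
  · simp [chordFn_pos, rad_of_spine hv]
  · refine chordFn_pos_neg le_rfl (by linarith) (by linarith) ?_
    simp only [sub_zero, add_zero, Nat.cast_lt]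
    exact lt_or_gt_of_ne fun h => hq (slot_injective h)

theorem chordFn_next_leaf_neg (hv : ¬ l.spine v) : chordFn l.radius l.unit
    (l.start (l.par v) + l.half (l.par v)) (l.half (l.par v)) (l.pos v) < 0 := by
  have h := leafRadius_mul_cos_lt (unit_pos (l := l)) (one_le_half (l.par v))
    (half_mul_unit (l.par v)) (Nat.cast_nonneg (l.idx v)) (idx_add_one_le hv)
  rw [← rad_of_not_spine hv] at h
  rw [chordFn_pos, slot_of_not_spine hv]
  push_cast
  rw [add_sub_cancel_left]
  exact mul_neg_of_pos_of_neg radius_pos (sub_neg.2 h)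

theorem chordFn_next_start (hu : l.spine u) : chordFn l.radius l.unit
    (l.start u + l.half u) (l.half u) (l.pos u) = 0 := by
  rw [chordFn_pos, slot_of_spine hu, rad_of_spine hu,
    show ((l.start u : ℝ) - (l.start u + l.half u)) * l.unit = -(l.half u * l.unit) by ring,
    Real.cos_neg]
  ring

theorem chordFn_next_end (hv : l.spine v) (h : l.start v = l.start u + 2 * l.half u) :
    chordFn l.radius l.unit (l.start u + l.half u) (l.half u) (l.pos v) = 0 := by
  rw [chordFn_pos, slot_of_spine hv, rad_of_spine hv, h]
  push_cast
  rw [show ((l.start u : ℝ) + 2 * l.half u - (l.start u + l.half u)) * l.unit =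
    l.half u * l.unit by ring]
  ring

/-- The line through two consecutive spine vertices has all other vertices on the same side. -/
theorem exists_edge_support (hu : l.spine u) (hv : l.spine v)
    (h : l.start v = l.start u + 2 * l.half u) : ∃ f, IsAffineFn f ∧ f (l.pos u) = 0 ∧
    f (l.pos v) = 0 ∧ ∀ q, q ≠ u → q ≠ v → f (l.pos q) < 0 := by
  refine ⟨_, isAffineFn_chordFn .., chordFn_next_start hu, chordFn_next_end hv h,
    fun q hqu hqv => ?_⟩
  have hb := start_cast_bounds hu
  have hh := one_le_half (l := l) u
  by_cases ho : l.owner q = u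
  · by_cases hs : l.spine q
    · rw [owner_of_spine hs] at ho
      exact absurd ho hqu
    · rw [owner_of_not_spine hs] at ho
      have := chordFn_next_leaf_neg hs
      rwa [ho] at this
  · refine chordFn_pos_neg (by linarith) (by linarith) (by linarith) ?_
    rcases slot_of_owner_ne hu ho with h' | h'
    · left
      have : (l.slot q : ℝ) + 2 ≤ l.start u := by exact_mod_cast h'
      linarith
    · right
      have hne : l.slot q ≠ l.slot v := fun h => hqv (slot_injective h)
      rw [slot_of_spine hv, h] at hne
      have : (l.start u : ℝ) + 2 * l.half u + 1 ≤ l.slot q := by exact_mod_cast (by omega)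
      linarith

/-- No leaf lies on the segment between its neighbour and a third vertex. -/
theorem pos_notMem_segment (hv : ¬ l.spine v) (hqv : q ≠ v) (hqu : q ≠ l.par v) :
    l.pos v ∉ segment ℝ (l.pos (l.par v)) (l.pos q) := by
  rintro ⟨s, t, hs, ht, hst, he⟩
  set u := l.par v with hu_def
  have hu : l.spine u := l.spine_par v hv
  have hb := start_cast_bounds hu
  have hh := one_le_half (l := l) u
  by_cases ho : l.owner q = u
  · have hsq : ¬ l.spine q := by
      intro hsq
      rw [owner_of_spine hsq] at ho
      exact hqu ho
    rw [owner_of_not_spine hsq] at ho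
    -- The tangent at the sibling leaf `q`, rather than at `v`: it is nonnegative on the whole
    -- segment from `u` to `q` and negative at `v`.
    obtain ⟨f, hf, fq, fu, fo⟩ := exists_leaf_support hsq
    have e := congrArg f he
    rw [hf.apply_combo hst, fq] at e
    rw [ho] at fu fo
    have h1 := fo v hqv.symm (fun h => hv (h ▸ hu))
    have h2 := mul_nonneg hs fu.le
    linarith
  -- Only the next spine vertex can occupy this slot, because leaves never take the first slot of a
  -- block. It lies outside the chord used in the general case, so the spine edge itself serves as
  -- the separating line.
  · by_cases hlast : l.slot q = l.start u + 2 * l.half u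
    · have hsq : l.spine q := by
        by_contra hsq
        have h1 := l.disjoint _ _ (spine_owner q) hu ho
        have h2 := l.half_pos (l.par q)
        rw [owner_of_not_spine hsq] at h1
        rw [slot_of_not_spine hsq] at hlast
        have h3 := l.idx_lt q hsq
        omega
      have e := congrArg (chordFn l.radius l.unit (l.start u + l.half u) (l.half u)) he
      rw [(isAffineFn_chordFn ..).apply_combo hst, chordFn_next_start hu,
        chordFn_next_end hsq (by rw [← hlast, slot_of_spine hsq])] at e
      have := chordFn_next_leaf_neg hv
      rw [← hu_def] at this
      linarith
    -- This chord runs from `u` to slot `start u + 2 * half u + 1`. It has the width of the leaf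
    -- chord but is shifted by one slot, leaving `u` on it and `q` not outside it.
    · have e := congrArg
        (chordFn l.radius l.unit (l.start u + l.half u + 1 / 2) (l.half u + 1 / 2)) he
      rw [(isAffineFn_chordFn ..).apply_combo hst] at e
      have h1 : chordFn l.radius l.unit (l.start u + l.half u + 1 / 2) (l.half u + 1 / 2)
          (l.pos u) ≤ 0 := by
        refine chordFn_pos_nonpos (by linarith) (by linarith) (by linarith) (Or.inl ?_)
        rw [slot_of_spine hu]
        linarith
      have h2 : chordFn l.radius l.unit (l.start u + l.half u + 1 / 2) (l.half u + 1 / 2)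
          (l.pos q) ≤ 0 := by
        refine chordFn_pos_nonpos (by linarith) (by linarith) (by linarith) ?_
        rcases slot_of_owner_ne hu ho with h' | h'
        · left
          have : (l.slot q : ℝ) + 2 ≤ l.start u := by exact_mod_cast h'
          linarith
        · right
          have : (l.start u : ℝ) + 2 * l.half u + 1 ≤ l.slot q := by exact_mod_cast (by omega)
          linarith
      have h3 : 0 < chordFn l.radius l.unit (l.start u + l.half u + 1 / 2) (l.half u + 1 / 2)
          (l.pos v) := by
        have h := lt_leafRadius_mul (unit_pos (l := l)) (one_le_half (l.par v))
          (half_mul_unit (l.par v)) (Nat.cast_nonneg (l.idx v)) (idx_add_one_le hv)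
        rw [← rad_of_not_spine hv] at h
        rw [chordFn_pos]
        refine mul_pos radius_pos (sub_pos.2 (h.trans_le ?_))
        -- From the middle of the shifted chord the leaf has offset `idx v - 1 / 2`, of absolute
        -- value at most its offset `idx v + 1 / 2` from the middle of the leaf chord.
        refine mul_le_mul_of_nonneg_left ?_ (rad_pos v).le
        rw [slot_of_not_spine hv, ← hu_def]
        push_cast
        have hi := idx_add_one_le hv
        rw [← hu_def] at hi
        have hi0 : (0 : ℝ) ≤ l.idx v := Nat.cast_nonneg _
        rw [← Real.cos_abs ((_ - _) * _), abs_mul, abs_of_pos (unit_pos (l := l))]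
        refine Real.cos_le_cos_of_nonneg_of_le_pi ?_ ?_ ?_
        · exact mul_nonneg (abs_nonneg _) unit_pos.le
        · have := half_mul_unit (l := l) u
          have := Real.pi_pos
          have := unit_pos (l := l)
          nlinarith
        · refine mul_le_mul_of_nonneg_right ?_ unit_pos.le
          rw [abs_le]
          constructor <;> linarith
      have h4 := mul_nonpos_of_nonneg_of_nonpos hs h1
      have h5 := mul_nonpos_of_nonneg_of_nonpos ht h2
      linarith

/-- A block layout draws every tree whose edges join consecutive spine vertices or a leaf to its
spine vertex without crossings. -/
theorem isCompatibleDrawing {G S : SimpleGraph V}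
    (hedge : ∀ a b, S.Adj a b → (¬ l.spine a ∧ b = l.par a) ∨ (¬ l.spine b ∧ a = l.par b) ∨
      (l.spine a ∧ l.spine b ∧ (l.start b = l.start a + 2 * l.half a ∨
        l.start a = l.start b + 2 * l.half b))) :
    IsCompatibleDrawing G S l.pos := by
  refine isCompatibleDrawing_of_separation l.spine l.par pos_injective
    (fun v hv => exists_spine_support hv) (fun v hv => exists_leaf_support hv)
    (fun v hv q h1 h2 => pos_notMem_segment hv h1 h2) fun a b hab => ?_
  rcases hedge a b hab with h | h | ⟨ha, hb, h | h⟩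
  · exact Or.inl h
  · exact Or.inr (Or.inl h)
  · exact Or.inr (Or.inr (exists_edge_support ha hb h))
  · obtain ⟨f, hf, fb, fa, fo⟩ := exists_edge_support hb ha h
    exact Or.inr (Or.inr ⟨f, hf, fa, fb, fun q h1 h2 => fo q h2 h1⟩)

/-! ### Position relative to the origin, and the common arc of the leaves -/

theorem dist_pos_zero (v : V) : dist (l.pos v) 0 = l.radius * l.rad v := by
  rw [pos, dist_polarPoint_zero, abs_of_pos (mul_pos radius_pos (rad_pos v))]

theorem pos_mem_box (v : V) :
    -l.radius ≤ l.pos v 0 ∧ l.pos v 0 ≤ 0 ∧ 0 ≤ l.pos v 1 ∧ l.pos v 1 ≤ l.radius := by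
  have hs := slot_cast_bounds (l := l) v
  have hr := mul_pos (radius_pos (l := l)) (rad_pos (l := l) v)
  have hr' := mul_le_of_le_one_right (radius_pos (l := l)).le (rad_le_one (l := l) v)
  have h0 : 0 ≤ l.slot v * l.unit := mul_nonneg (Nat.cast_nonneg _) unit_pos.le
  have h1 : l.slot v * l.unit ≤ Real.pi / 2 := by
    rw [← unit_mul]
    exact mul_le_mul_of_nonneg_right (by linarith) unit_pos.le
  have hpi := Real.pi_pos
  have hc : 0 ≤ Real.cos (l.slot v * l.unit) :=
    Real.cos_nonneg_of_neg_pi_div_two_le_of_le (by linarith) h1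
  have hsin : 0 ≤ Real.sin (l.slot v * l.unit) :=
    Real.sin_nonneg_of_nonneg_of_le_pi h0 (by linarith)
  have hc1 := mul_le_of_le_one_right hr.le (Real.cos_le_one (l.slot v * l.unit))
  have hs1 := mul_le_of_le_one_right hr.le (Real.sin_le_one (l.slot v * l.unit))
  have hc0 := mul_nonneg hr.le hc
  have hs0 := mul_nonneg hr.le hsin
  simp only [pos, polarPoint_zero, polarPoint_one]
  refine ⟨by linarith, by linarith, hs0, by linarith⟩

/-- The leaves of a spine vertex lie on a circle. -/
theorem cospherical (u : V) :
    EuclideanGeometry.Cospherical (l.pos '' {v | ¬ l.spine v ∧ l.par v = u}) := by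
  set w := l.radius * leafWeight l.unit (l.half u) with hw
  set y := ((l.start u + l.half u - 1 / 2 : ℝ)) * l.unit with hy
  set c := l.radius * Real.cos ((l.half u + 1 / 2) * l.unit) with hc
  -- Center and radius come from completing the square in `leafPower u p = 0`.
  refine ⟨!₂[w / 2 * Real.cos y, -(w / 2 * Real.sin y)],
    Real.sqrt (l.radius ^ 2 + w * c + (w / 2) ^ 2), ?_⟩
  rintro _ ⟨v, ⟨hv, rfl⟩, rfl⟩
  have h := leafPower_leaf hv
  simp only [leafPower, chordFn, ← hw, ← hy, ← hc] at h
  rw [← Real.sqrt_sq (dist_nonneg (x := l.pos v))]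
  congr 1
  rw [dist_sq_eq_coord]
  simp only [Matrix.cons_val_zero, Matrix.cons_val_one]
  linear_combination h + (w / 2) ^ 2 * Real.sin_sq_add_cos_sq y

end BlockLayout

/-! ## The area of a drawing -/

theorem extent_le {X : Set Plane} {i : Fin 2} {a b : ℝ} (hX : X.Nonempty)
    (h : ∀ p ∈ X, a ≤ p i ∧ p i ≤ b) : 0 ≤ extent X i ∧ extent X i ≤ b - a := by
  have hne : ((fun p : Plane => p i) '' X).Nonempty := hX.image _
  have hb : BddBelow ((fun p : Plane => p i) '' X) :=
    ⟨a, by rintro _ ⟨p, hp, rfl⟩; exact (h p hp).1⟩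
  have ha : BddAbove ((fun p : Plane => p i) '' X) :=
    ⟨b, by rintro _ ⟨p, hp, rfl⟩; exact (h p hp).2⟩
  refine ⟨sub_nonneg.2 (csInf_le_csSup hne hb ha), sub_le_sub ?_ ?_⟩
  · exact csSup_le hne (by rintro _ ⟨p, hp, rfl⟩; exact (h p hp).2)
  · exact le_csInf hne (by rintro _ ⟨p, hp, rfl⟩; exact (h p hp).1)

theorem drawnPoints_bounds {V : Type*} (G : SimpleGraph V) {pos : V → Plane} {i : Fin 2} {a b : ℝ}
    (h : ∀ v, a ≤ pos v i ∧ pos v i ≤ b) : ∀ p ∈ drawnPoints G pos, a ≤ p i ∧ p i ≤ b := by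
  rintro p (⟨v, rfl⟩ | ⟨x, y, -, s, t, hs, ht, hst, rfl⟩)
  · exact h v
  · have hx := h x
    have hy := h y
    simp only [PiLp.add_apply, PiLp.smul_apply, smul_eq_mul]
    have : s = 1 - t := by linarith
    subst this
    constructor <;> nlinarith

theorem drawingArea_le {V : Type*} [Nonempty V] (G : SimpleGraph V) {pos : V → Plane} {R : ℝ}
    (h : ∀ v, -R ≤ pos v 0 ∧ pos v 0 ≤ 0 ∧ 0 ≤ pos v 1 ∧ pos v 1 ≤ R) :
    drawingArea G pos ≤ R ^ 2 := by
  have hne : (drawnPoints G pos).Nonempty := ⟨_, Or.inl ⟨Classical.arbitrary V, rfl⟩⟩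
  have h0 := extent_le hne (drawnPoints_bounds G (i := 0) (fun v => ⟨(h v).1, (h v).2.1⟩))
  have h1 := extent_le hne (drawnPoints_bounds G (i := 1) (fun v => (h v).2.2))
  rw [zero_sub, neg_neg] at h0
  rw [sub_zero] at h1
  rw [drawingArea, sq]
  exact mul_le_mul h0.2 h1.2 h1.1 (h0.1.trans h0.2)

/-! ## Running programs -/

namespace RealRAM

theorem State.storeNat_nat (s : State) (a i k b j : ℕ) :
    (s.storeNat a i k).nat b j = if b = a ∧ j = i then k else s.nat b j := by
  by_cases hb : b = a
  · subst hb
    simp [State.storeNat, Function.update_apply]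
  · simp [State.storeNat, hb]

@[simp] theorem State.storeNat_real (s : State) (a i k : ℕ) :
    (s.storeNat a i k).real = s.real := rfl

theorem State.storeReal_real (s : State) (a i : ℕ) (x : ℝ) (b j : ℕ) :
    (s.storeReal a i x).real b j = if b = a ∧ j = i then x else s.real b j := by
  by_cases hb : b = a
  · subst hb
    simp [State.storeReal, Function.update_apply]
  · simp [State.storeReal, hb]

@[simp] theorem State.storeReal_nat (s : State) (a i : ℕ) (x : ℝ) :
    (s.storeReal a i x).nat = s.nat := rfl

namespace Program

/-- A program without loops. -/
def LoopFree : Program → Prop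
  | skip => True
  | setNat _ _ _ => True
  | setReal _ _ _ => True
  | seq p q => p.LoopFree ∧ q.LoopFree
  | ite _ p q => p.LoopFree ∧ q.LoopFree
  | .while _ _ => False

/-- The arrays of natural numbers that a program stores to. -/
def writes : Program → List ℕ
  | skip => []
  | setNat a _ _ => [a]
  | setReal _ _ _ => []
  | seq p q => p.writes ++ q.writes
  | ite _ p q => p.writes ++ q.writes
  | .while _ p => p.writes

/-- A bound for the number of steps of a loop-free program. -/
def maxCost : Program → ℕ
  | skip => 1
  | setNat _ i e => i.cost + e.cost + 1
  | setReal _ i x => i.cost + x.cost + 1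
  | seq p q => p.maxCost + q.maxCost
  | ite b p q => b.cost + (p.maxCost + q.maxCost)
  | .while _ _ => 0

open Classical in
/-- The final state of a loop-free program. -/
noncomputable def exec : Program → State → State
  | skip, s => s
  | setNat a i e, s => s.storeNat a (i.value s) (e.value s)
  | setReal a i x, s => s.storeReal a (i.value s) (x.value s)
  | seq p q, s => q.exec (p.exec s)
  | ite b p q, s => if b.Holds s then p.exec s else q.exec s
  | .while _ _, s => s

theorem exec_ite_pos {b : Test} {s : State} (h : b.Holds s) (p q : Program) :
    (ite b p q).exec s = p.exec s := if_pos h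

theorem exec_ite_neg {b : Test} {s : State} (h : ¬ b.Holds s) (p q : Program) :
    (ite b p q).exec s = q.exec s := if_neg h

theorem run_exec : ∀ (p : Program) (s : State), p.LoopFree →
    ∃ t, Run p s t (p.exec s) ∧ t ≤ p.maxCost
  | skip, s, _ => ⟨1, Run.skip s, le_rfl⟩
  | setNat a i e, s, _ => ⟨_, Run.setNat s a i e, le_rfl⟩
  | setReal a i x, s, _ => ⟨_, Run.setReal s a i x, le_rfl⟩
  | seq p q, s, h => by
      obtain ⟨t, h1, h2⟩ := run_exec p s h.1
      obtain ⟨t', h3, h4⟩ := run_exec q (p.exec s) h.2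
      exact ⟨t + t', Run.seq h1 h3, Nat.add_le_add h2 h4⟩
  | ite b p q, s, h => by
      by_cases hb : b.Holds s
      · obtain ⟨t, h1, h2⟩ := run_exec p s h.1
        refine ⟨b.cost + t, ?_, by simp only [maxCost]; omega⟩
        rw [exec_ite_pos hb]
        exact Run.ite_true hb h1
      · obtain ⟨t, h1, h2⟩ := run_exec q s h.2
        refine ⟨b.cost + t, ?_, by simp only [maxCost]; omega⟩
        rw [exec_ite_neg hb]
        exact Run.ite_false hb h1
  | .while _ _, _, h => h.elim

theorem exec_nat_of_notMem : ∀ (p : Program) (s : State) (a : ℕ), a ∉ p.writes →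
    (p.exec s).nat a = s.nat a
  | skip, s, a, _ => rfl
  | setNat b i e, s, a, h => by
      simp only [writes, List.mem_singleton] at h
      simp [exec, State.storeNat, h]
  | setReal b i x, s, a, _ => rfl
  | seq p q, s, a, h => by
      simp only [writes, List.mem_append, not_or] at h
      rw [exec, exec_nat_of_notMem q _ a h.2, exec_nat_of_notMem p s a h.1]
  | ite b p q, s, a, h => by
      simp only [writes, List.mem_append, not_or] at h
      rw [exec]
      split
      · exact exec_nat_of_notMem p s a h.1
      · exact exec_nat_of_notMem q s a h.2
  | .while _ _, _, _, _ => rfl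

end Program

/-- Program `p` started in `s` halts after at most `b` steps in a state with property `Q`. -/
def Runs (p : Program) (s : State) (b : ℕ) (Q : State → Prop) : Prop :=
  ∃ t s', Run p s t s' ∧ t ≤ b ∧ Q s'

theorem Runs.mono {p : Program} {s : State} {b : ℕ} {Q Q' : State → Prop} (h : Runs p s b Q)
    (h' : ∀ s', Q s' → Q' s') : Runs p s b Q' := by
  obtain ⟨t, s', h1, h2, h3⟩ := h
  exact ⟨t, s', h1, h2, h' s' h3⟩

theorem Runs.seq {p q : Program} {s : State} {b c : ℕ} {Q Q' : State → Prop} (h : Runs p s b Q)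
    (h' : ∀ s', Q s' → Runs q s' c Q') : Runs (.seq p q) s (b + c) Q' := by
  obtain ⟨t, s', h1, h2, h3⟩ := h
  obtain ⟨t', s'', h4, h5, h6⟩ := h' s' h3
  exact ⟨t + t', s'', Run.seq h1 h4, Nat.add_le_add h2 h5, h6⟩

theorem runs_of_loopFree {p : Program} {s : State} {Q : State → Prop} (h : p.LoopFree)
    (hQ : Q (p.exec s)) : Runs p s p.maxCost Q := by
  obtain ⟨t, h1, h2⟩ := p.run_exec s h
  exact ⟨t, _, h1, h2, hQ⟩

/-- The loop counter. -/
def counter : NatExpr := .load 10 (.const 0)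

/-- The body of a counting loop, followed by incrementing the counter. -/
def loopBody (body : Program) : Program :=
  .seq body (.setNat 10 (.const 0) (.add counter (.const 1)))

/-- A loop in which the counter runs from zero to the value of cell `j` of array `c`. -/
def forLoop (c j : ℕ) (body : Program) : Program :=
  .seq (.setNat 10 (.const 0) (.const 0))
    (.while (.natLt counter (.load c (.const j))) (loopBody body))

/-- A bound for the number of steps of one round of a counting loop. -/
def roundCost (body : Program) : ℕ := (loopBody body).maxCost + 8

/-- Correctness of a loop reduces to one application of `exec` per round. Arrays not written by the
body are known to keep their initial contents, so `Inv` need only describe the written ones. -/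
theorem runs_forLoop {c j : ℕ} {body : Program} (hb : body.LoopFree) (h10 : 10 ∉ body.writes)
    (hc : c ∉ body.writes) (hc10 : c ≠ 10) (Inv : ℕ → State → Prop) (s₀ : State)
    (h0 : Inv 0 (s₀.storeNat 10 0 0))
    (hstep : ∀ i s, i < s₀.nat c j → s.nat 10 0 = i →
      (∀ a, a ≠ 10 → a ∉ body.writes → s.nat a = s₀.nat a) → Inv i s →
      Inv (i + 1) ((body.exec s).storeNat 10 0 (i + 1))) :
    Runs (forLoop c j body) s₀ (roundCost body * (s₀.nat c j + 1)) fun s =>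
      (∀ a, a ≠ 10 → a ∉ body.writes → s.nat a = s₀.nat a) ∧ Inv (s₀.nat c j) s := by
  -- Induction on the number `d` of remaining rounds; the `5` pays for the final failing test.
  have main : ∀ d i s, i + d = s₀.nat c j → s.nat 10 0 = i →
      (∀ a, a ≠ 10 → a ∉ body.writes → s.nat a = s₀.nat a) → Inv i s →
      Runs (.while (.natLt counter (.load c (.const j))) (loopBody body)) s
        (roundCost body * d + 5) fun s =>
        (∀ a, a ≠ 10 → a ∉ body.writes → s.nat a = s₀.nat a) ∧ Inv (s₀.nat c j) s := by
    intro d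
    induction d with
    | zero =>
      intro i s hi hcount hframe hinv
      refine ⟨_, s, Run.while_false ?_, ?_, hframe, ?_⟩
      · simp only [Test.Holds, counter, NatExpr.value, hcount, hframe c hc10 hc]
        omega
      · simp [Test.cost, counter, NatExpr.cost]
      · rw [← hi]
        exact hinv
    | succ d ih =>
      intro i s hi hcount hframe hinv
      obtain ⟨t, h1, h2⟩ := (loopBody body).run_exec s ⟨hb, trivial⟩
      have he : (loopBody body).exec s = (body.exec s).storeNat 10 0 (i + 1) := by
        simp only [loopBody, Program.exec, counter, NatExpr.value,
          Program.exec_nat_of_notMem body s 10 h10, hcount]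
      rw [he] at h1
      obtain ⟨t', s', h3, h4, h5⟩ := ih (i + 1) ((body.exec s).storeNat 10 0 (i + 1)) (by omega)
        (by simp [State.storeNat]) (fun a ha hw => by
          simp only [State.storeNat, Function.update_of_ne ha]
          rw [Program.exec_nat_of_notMem body s a hw, hframe a ha hw])
        (hstep i s (by omega) hcount hframe hinv)
      refine ⟨_, s', Run.while_true ?_ h1 h3, ?_, h5⟩
      · simp only [Test.Holds, counter, NatExpr.value, hcount, hframe c hc10 hc]
        omega
      · have : (Test.natLt counter (.load c (.const j))).cost = 5 := by
          simp [Test.cost, counter, NatExpr.cost]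
        rw [this, roundCost, mul_add]
        rw [roundCost] at h4
        omega
  obtain ⟨t, s, h1, h2, h3⟩ := main (s₀.nat c j) 0 (s₀.storeNat 10 0 0) (by omega)
    (by simp [State.storeNat]) (fun a ha _ => by simp [State.storeNat, ha]) h0
  refine ⟨_, s, Run.seq (Run.setNat s₀ 10 (.const 0) (.const 0)) h1, ?_, h3⟩
  simp only [NatExpr.cost]
  rw [mul_add, mul_one]
  have : 8 ≤ roundCost body := by simp [roundCost]
  omega

end RealRAM

/-! ## The drawing program -/

/-- For every edge at `v` (in the edge list given by the arrays `A` and `B` of length `m`), add up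
the value of `f` at the other end. -/
def edgeSum (m : ℕ) (A B f : ℕ → ℕ) (v : ℕ) : ℕ :=
  ∑ j ∈ Finset.range m,
    ((if A j = v then f (B j) else 0) + (if B j = v then f (A j) else 0))

/-- The number of `w < i` outside `flag` with `nb w = u`. -/
def leafCount (flag nb : ℕ → ℕ) (i u : ℕ) : ℕ :=
  ((Finset.range i).filter fun w => flag w ≠ 1 ∧ nb w = u).card

namespace RealRAM

/-- Every vertex gets weight one. -/
def onesBody : Program := .setNat 5 counter (.const 1)

/-- Add the weight in array `src` of each end of the current edge to the other end. -/
def accBody (dst src : ℕ) : Program :=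
  .seq (.setNat dst (.load 3 counter)
      (.add (.load dst (.load 3 counter)) (.load src (.load 4 counter))))
    (.setNat dst (.load 4 counter)
      (.add (.load dst (.load 4 counter)) (.load src (.load 3 counter))))

/-- Mark the current vertex as a spine vertex. -/
def markBody : Program :=
  .seq (.setNat 7 counter (.const 1)) (.seq (.setNat 8 counter counter)
    (.setNat 21 (.const 0) (.add (.load 21 (.const 0)) (.const 1))))

/-- Recognize the spine vertices by their degree; if there are only two vertices, one of them is
taken as the spine. -/
def flagBody : Program :=
  .ite (.not (.natEq (.load 6 counter) (.const 1))) markBody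
    (.ite (.natEq (.add (.load 0 (.const 0)) counter) (.const 2)) markBody .skip)

/-- Number the leaves of each spine vertex, and find an end of the spine. -/
def indexBody : Program :=
  .ite (.natEq (.load 7 counter) (.const 1))
    (.ite (.natLt (.load 9 counter) (.const 2)) (.setNat 14 (.const 0) counter) .skip)
    (.seq (.setNat 13 counter (.load 12 (.load 11 counter)))
      (.setNat 12 (.load 11 counter) (.add (.load 12 (.load 11 counter)) (.const 1))))

/-- The current vertex of the walk along the spine. -/
def cur : NatExpr := .load 15 (.const 0)

/-- Visit a spine vertex and proceed to the next one. -/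
def walkBody : Program :=
  .seq (.setNat 18 cur (.load 17 (.const 0)))
    (.seq (.setNat 17 (.const 0) (.add (.load 17 (.const 0))
        (.add (.add (.load 12 cur) (.const 1)) (.add (.load 12 cur) (.const 1)))))
      (.seq (.setNat 20 (.const 0) (.sub (.load 11 cur) (.load 16 (.const 0))))
        (.seq (.setNat 16 (.const 0) cur) (.setNat 15 (.const 0) (.load 20 (.const 0))))))

/-! ### What the passes over vertices, edges and the spine compute -/

theorem runs_ones (s₀ : State) (h : s₀.nat 5 = fun _ => 0) :
    Runs (forLoop 0 0 onesBody) s₀ (roundCost onesBody * (s₀.nat 0 0 + 1)) fun s =>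
      (∀ a, a ≠ 10 → a ∉ onesBody.writes → s.nat a = s₀.nat a) ∧
        s.nat 5 = fun v => if v < s₀.nat 0 0 then 1 else 0 := by
  refine runs_forLoop (body := onesBody) trivial (by decide) (by decide) (by decide)
    (fun i s => s.nat 5 = fun v => if v < i then 1 else 0) s₀ ?_ ?_
  · funext v
    simp [State.storeNat_nat, h]
  · intro i s hi hcount hframe hinv
    funext v
    simp only [onesBody, Program.exec, State.storeNat_nat, counter, NatExpr.value, hcount, hinv]
    norm_num
    split_ifs <;> omega

theorem runs_acc {dst src : ℕ} (h3 : dst ≠ 3) (h4 : dst ≠ 4) (h10 : dst ≠ 10) (h0 : dst ≠ 0)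
    (hs : src ≠ dst) (hs10 : src ≠ 10) (s₀ : State) (h : s₀.nat dst = fun _ => 0) :
    Runs (forLoop 0 2 (accBody dst src)) s₀ (roundCost (accBody dst src) * (s₀.nat 0 2 + 1))
      fun s => (∀ a, a ≠ 10 → a ∉ (accBody dst src).writes → s.nat a = s₀.nat a) ∧
        s.nat dst = edgeSum (s₀.nat 0 2) (s₀.nat 3) (s₀.nat 4) (s₀.nat src) := by
  have hw : ∀ a, a ∉ (accBody dst src).writes ↔ a ≠ dst := by
    simp [accBody, Program.writes]
  refine runs_forLoop (body := accBody dst src) ⟨trivial, trivial⟩ ((hw _).2 h10.symm)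
    ((hw _).2 h0.symm) (by decide)
    (fun i s => s.nat dst = edgeSum i (s₀.nat 3) (s₀.nat 4) (s₀.nat src)) s₀ ?_ ?_
  · funext v
    simp [State.storeNat_nat, h, h10, edgeSum]
  · intro i s hi hcount hframe hinv
    have e3 := hframe 3 (by decide) ((hw _).2 h3.symm)
    have e4 := hframe 4 (by decide) ((hw _).2 h4.symm)
    have es := hframe src hs10 ((hw _).2 hs)
    funext v
    simp only [accBody, Program.exec, State.storeNat_nat, counter, NatExpr.value, hcount,
      hinv, h10, h10.symm, h3.symm, h4.symm, hs, if_false, false_and, true_and,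
      e3, e4, es, edgeSum, Finset.sum_range_succ]
    by_cases a1 : v = s₀.nat 3 i <;> by_cases a2 : v = s₀.nat 4 i
    · rw [← a1, ← a2]
      simp only [if_true]
      omega
    · simp only [← a1, a2, Ne.symm a2, if_true, if_false]
      omega
    · simp only [← a2, a1, Ne.symm a1, if_true, if_false]
      omega
    · simp only [a1, a2, Ne.symm a1, Ne.symm a2, if_false]
      omega

theorem runs_flag (s₀ : State) (h7 : s₀.nat 7 = fun _ => 0) (h8 : s₀.nat 8 = fun _ => 0)
    (h21 : s₀.nat 21 = fun _ => 0) (flag : ℕ → ℕ)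
    (hflag : ∀ v, flag v = if v < s₀.nat 0 0 ∧ (s₀.nat 6 v ≠ 1 ∨ s₀.nat 0 0 + v = 2)
      then 1 else 0) :
    Runs (forLoop 0 0 flagBody) s₀ (roundCost flagBody * (s₀.nat 0 0 + 1)) fun s =>
      (∀ a, a ≠ 10 → a ∉ flagBody.writes → s.nat a = s₀.nat a) ∧
        s.nat 7 = flag ∧ (s.nat 8 = fun v => if flag v = 1 then v else 0) ∧
        s.nat 21 0 = ∑ v ∈ Finset.range (s₀.nat 0 0), flag v := by
  have hfin : ∀ v, ¬ v < s₀.nat 0 0 → flag v = 0 := by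
    intro v hv
    rw [hflag, if_neg (fun h => hv h.1)]
  refine (runs_forLoop (body := flagBody) ⟨⟨trivial, trivial, trivial⟩, ⟨trivial, trivial, trivial⟩, trivial⟩
    (by decide) (by decide) (by decide)
    (fun i s => (s.nat 7 = fun v => if v < i then flag v else 0) ∧
      (s.nat 8 = fun v => if v < i ∧ flag v = 1 then v else 0) ∧
      s.nat 21 0 = ∑ v ∈ Finset.range i, flag v) s₀ ?_ ?_).mono ?_
  · refine ⟨?_, ?_, ?_⟩
    · funext v
      simp [State.storeNat_nat, h7]
    · funext v
      simp [State.storeNat_nat, h8]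
    · simp [State.storeNat_nat, h21]
  · rintro i s hi hcount hframe ⟨i7, i8, i21⟩
    have e0 := hframe 0 (by decide) (by decide)
    have e6 := hframe 6 (by decide) (by decide)
    -- All three branches of the body act as `markBody` or `skip` according to `flag i`.
    have hmark : ∀ p : Program, (flag i = 1 → p = markBody) → (flag i = 0 → p = .skip) →
        (((p.exec s).storeNat 10 0 (i + 1)).nat 7 = fun v => if v < i + 1 then flag v else 0) ∧
        (((p.exec s).storeNat 10 0 (i + 1)).nat 8 =
          fun v => if v < i + 1 ∧ flag v = 1 then v else 0) ∧
        ((p.exec s).storeNat 10 0 (i + 1)).nat 21 0 =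
          ∑ v ∈ Finset.range (i + 1), flag v := by
      intro p p1 p0
      have h01 : flag i = 1 ∨ flag i = 0 := by
        rw [hflag i]
        split_ifs <;> simp
      rcases h01 with h01 | h01
      · rw [p1 h01]
        refine ⟨?_, ?_, ?_⟩
        · funext v
          simp only [markBody, Program.exec, State.storeNat_nat, counter, NatExpr.value, hcount, i7]
          norm_num
          by_cases hv : v = i
          · simp [hv, h01]
          · simp only [hv, if_false]
            split_ifs <;> first | rfl | omega
        · funext v
          simp only [markBody, Program.exec, State.storeNat_nat, counter, NatExpr.value, hcount, i8]
          norm_num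
          by_cases hv : v = i
          · simp [hv, h01]
          · simp only [hv, if_false]
            split_ifs <;> first | rfl | omega
        · simp [markBody, Program.exec, State.storeNat_nat, counter, NatExpr.value, hcount, i21,
            Finset.sum_range_succ, h01]
      · rw [p0 h01]
        refine ⟨?_, ?_, ?_⟩
        · funext v
          simp only [Program.exec, State.storeNat_nat, i7]
          norm_num
          by_cases hv : v = i
          · simp [hv, h01]
          · split_ifs <;> first | rfl | omega
        · funext v
          simp only [Program.exec, State.storeNat_nat, i8]
          norm_num
          by_cases hv : v = i
          · simp [hv, h01]
          · split_ifs <;> first | rfl | omega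
        · simp [Program.exec, State.storeNat_nat, i21, Finset.sum_range_succ, h01]
    by_cases c1 : s₀.nat 6 i ≠ 1
    · have := hmark markBody (fun _ => rfl) (fun h => by
        rw [hflag, if_pos ⟨hi, Or.inl c1⟩] at h
        omega)
      have he : flagBody.exec s = markBody.exec s := by
        rw [flagBody, Program.exec_ite_pos]
        simpa [Test.Holds, counter, NatExpr.value, hcount, e6] using c1
      rwa [he]
    · by_cases c2 : s₀.nat 0 0 + i = 2
      · have := hmark markBody (fun _ => rfl) (fun h => by
          rw [hflag, if_pos ⟨hi, Or.inr c2⟩] at h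
          omega)
        have he : flagBody.exec s = markBody.exec s := by
          rw [flagBody, Program.exec_ite_neg, Program.exec_ite_pos]
          · simpa [Test.Holds, counter, NatExpr.value, hcount, e0] using c2
          · simpa [Test.Holds, counter, NatExpr.value, hcount, e6] using c1
        rwa [he]
      · have := hmark .skip (fun h => by
          rw [hflag, if_neg (by tauto)] at h
          omega) (fun _ => rfl)
        have he : flagBody.exec s = Program.skip.exec s := by
          rw [flagBody, Program.exec_ite_neg, Program.exec_ite_neg]
          · simpa [Test.Holds, counter, NatExpr.value, hcount, e0] using c2
          · simpa [Test.Holds, counter, NatExpr.value, hcount, e6] using c1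
        rwa [he]
  · rintro s ⟨hframe, i7, i8, i21⟩
    refine ⟨hframe, ?_, ?_, i21⟩
    · rw [i7]
      funext v
      split_ifs with h
      · rfl
      · exact (hfin v h).symm
    · rw [i8]
      funext v
      by_cases h : v < s₀.nat 0 0
      · simp [h]
      · simp [h, hfin v h]

/-- The running count of leaves at a parent, read before it is incremented, is the index of the
current leaf. A spine vertex with fewer than two spine neighbours is an end of the spine; any such
vertex may be recorded. -/
theorem runs_index (s₀ : State) (h12 : s₀.nat 12 = fun _ => 0) (flag nb : ℕ → ℕ)
    (h7 : s₀.nat 7 = flag) (h11 : s₀.nat 11 = nb) :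
    Runs (forLoop 0 0 indexBody) s₀ (roundCost indexBody * (s₀.nat 0 0 + 1)) fun s =>
      (∀ a, a ≠ 10 → a ∉ indexBody.writes → s.nat a = s₀.nat a) ∧
        s.nat 12 = leafCount flag nb (s₀.nat 0 0) ∧
        (∀ v < s₀.nat 0 0, flag v ≠ 1 → s.nat 13 v = leafCount flag nb v (nb v)) ∧
        ((∃ v < s₀.nat 0 0, flag v = 1 ∧ s₀.nat 9 v < 2) →
          s.nat 14 0 < s₀.nat 0 0 ∧ flag (s.nat 14 0) = 1 ∧ s₀.nat 9 (s.nat 14 0) < 2) := by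
  refine runs_forLoop (body := indexBody) ⟨⟨trivial, trivial⟩, trivial, trivial⟩
    (by decide) (by decide) (by decide)
    (fun i s => s.nat 12 = leafCount flag nb i ∧
        (∀ v < i, flag v ≠ 1 → s.nat 13 v = leafCount flag nb v (nb v)) ∧
        ((∃ v < i, flag v = 1 ∧ s₀.nat 9 v < 2) →
          s.nat 14 0 < s₀.nat 0 0 ∧ flag (s.nat 14 0) = 1 ∧ s₀.nat 9 (s.nat 14 0) < 2)) s₀ ?_ ?_
  · refine ⟨?_, ?_, ?_⟩
    · funext v
      simp [State.storeNat_nat, h12, leafCount]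
    · simp
    · simp
  · rintro i s hi hcount hframe ⟨i12, i13, i14⟩
    have e7 := hframe 7 (by decide) (by decide)
    have e9 := hframe 9 (by decide) (by decide)
    have e11 := hframe 11 (by decide) (by decide)
    rw [h7] at e7
    rw [h11] at e11
    have hsucc : ∀ u, leafCount flag nb (i + 1) u =
        leafCount flag nb i u + if flag i ≠ 1 ∧ nb i = u then 1 else 0 := by
      intro u
      rw [leafCount, Finset.range_add_one, Finset.filter_insert]
      split_ifs with h
      · rw [Finset.card_insert_of_notMem (by simp), leafCount]
      · rw [leafCount, add_zero]
    by_cases c1 : flag i = 1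
    · have hc : ∀ p : Program, (¬ 12 ∈ p.writes) → (¬ 13 ∈ p.writes) →
          ((p.exec s).storeNat 10 0 (i + 1)).nat 12 = leafCount flag nb (i + 1) ∧
          (∀ v < i + 1, flag v ≠ 1 → ((p.exec s).storeNat 10 0 (i + 1)).nat 13 v =
            leafCount flag nb v (nb v)) := by
        intro p p12 p13
        refine ⟨?_, fun v hv hf => ?_⟩
        · funext u
          rw [hsucc, State.storeNat_nat, if_neg (by simp), p.exec_nat_of_notMem s 12 p12, i12]
          simp [c1]
        · rw [State.storeNat_nat, if_neg (by simp), p.exec_nat_of_notMem s 13 p13]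
          refine i13 v (lt_of_le_of_ne (by omega) ?_) hf
          rintro rfl
          exact hf c1
      by_cases c2 : s₀.nat 9 i < 2
      · have he : indexBody.exec s = (Program.setNat 14 (.const 0) counter).exec s := by
          rw [indexBody, Program.exec_ite_pos, Program.exec_ite_pos]
          · simpa [Test.Holds, counter, NatExpr.value, hcount, e9] using c2
          · simpa [Test.Holds, counter, NatExpr.value, hcount, e7] using c1
        rw [he]
        obtain ⟨a1, a2⟩ := hc (Program.setNat 14 (.const 0) counter) (by decide) (by decide)
        refine ⟨a1, a2, fun _ => ?_⟩
        simp [Program.exec, State.storeNat_nat, counter, NatExpr.value, hcount, hi, c1, c2]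
      · have he : indexBody.exec s = Program.skip.exec s := by
          rw [indexBody, Program.exec_ite_pos, Program.exec_ite_neg]
          · simpa [Test.Holds, counter, NatExpr.value, hcount, e9] using c2
          · simpa [Test.Holds, counter, NatExpr.value, hcount, e7] using c1
        rw [he]
        obtain ⟨a1, a2⟩ := hc Program.skip (by decide) (by decide)
        refine ⟨a1, a2, ?_⟩
        rintro ⟨v, hv, hv1, hv2⟩
        have hvi : v < i := by
          refine lt_of_le_of_ne (by omega) ?_
          rintro rfl
          exact c2 hv2
        simpa [Program.exec, State.storeNat_nat] using i14 ⟨v, hvi, hv1, hv2⟩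
    · have he : indexBody.exec s = (s.storeNat 13 i (leafCount flag nb i (nb i))).storeNat 12 (nb i)
          (leafCount flag nb i (nb i) + 1) := by
        rw [indexBody, Program.exec_ite_neg]
        · simp [Program.exec, State.storeNat_nat, counter, NatExpr.value, hcount, e11, i12]
        · simpa [Test.Holds, counter, NatExpr.value, hcount, e7] using c1
      rw [he]
      refine ⟨?_, ?_, ?_⟩
      · funext u
        rw [hsucc]
        simp only [State.storeNat_nat, i12, c1, ne_eq, not_false_eq_true, true_and]
        norm_num
        by_cases hu : u = nb i
        · simp [hu]
        · simp [hu, Ne.symm hu]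
      · intro v hv hf
        simp only [State.storeNat_nat]
        norm_num
        by_cases hvi : v = i
        · simp [hvi]
        · rw [if_neg hvi]
          exact i13 v (by omega) hf
      · rintro ⟨v, hv, hv1, hv2⟩
        have hvi : v < i := by
          refine lt_of_le_of_ne (by omega) ?_
          rintro rfl
          exact c1 hv1
        simpa [State.storeNat_nat] using i14 ⟨v, hvi, hv1, hv2⟩

/-- The first slot of the block of the `i`-th vertex in the sequence `u`. -/
def blockStart (cnt u : ℕ → ℕ) (i : ℕ) : ℕ := 1 + ∑ j ∈ Finset.range i, 2 * (cnt (u j) + 1)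

/-- The sum of the names of the spine neighbours, minus the name of the previous vertex, is the next
vertex. At the first vertex the initial value `0` of the previous vertex makes the subtraction
harmless. -/
theorem runs_walk (s₀ : State) (nb cnt : ℕ → ℕ) (u : ℕ → ℕ) (k : ℕ) (hk : s₀.nat 21 0 = k)
    (h11 : s₀.nat 11 = nb) (h12 : s₀.nat 12 = cnt) (h15 : s₀.nat 15 0 = u 0)
    (h16 : s₀.nat 16 0 = 0) (h17 : s₀.nat 17 0 = 1)
    (hu : ∀ i, i + 1 < k → u (i + 1) = nb (u i) - if i = 0 then 0 else u (i - 1))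
    (hinj : ∀ i < k, ∀ j < i, u i ≠ u j) :
    Runs (forLoop 21 0 walkBody) s₀ (roundCost walkBody * (k + 1)) fun s =>
      (∀ a, a ≠ 10 → a ∉ walkBody.writes → s.nat a = s₀.nat a) ∧
        ∀ i < k, s.nat 18 (u i) = blockStart cnt u i := by
  have := runs_forLoop (c := 21) (j := 0) (body := walkBody)
    ⟨trivial, trivial, trivial, trivial, trivial⟩
    (by decide) (by decide) (by decide)
    -- The guard `i < k` is needed because the value stored after the last spine vertex names no
    -- successor.
    (fun i s => (i < k → s.nat 15 0 = u i) ∧ (s.nat 16 0 = if i = 0 then 0 else u (i - 1)) ∧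
        s.nat 17 0 = blockStart cnt u i ∧ ∀ j < i, s.nat 18 (u j) = blockStart cnt u j) s₀ ?_ ?_
  · rw [hk] at this
    exact this.mono fun s hs => ⟨hs.1, hs.2.2.2.2⟩
  · simp [State.storeNat_nat, h15, h16, h17, blockStart]
  · rintro i s hi hcount hframe ⟨i15, i16, i17, i18⟩
    rw [hk] at hi
    have e11 := hframe 11 (by decide) (by decide)
    have e12 := hframe 12 (by decide) (by decide)
    rw [h11] at e11
    rw [h12] at e12
    replace i15 := i15 hi
    refine ⟨fun hi' => ?_, ?_, ?_, ?_⟩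
    · simp only [walkBody, cur, Program.exec, State.storeNat_nat, NatExpr.value, i15, i16, i17,
        e11, e12]
      norm_num
      exact (hu i hi').symm
    · simp [walkBody, cur, Program.exec, State.storeNat_nat, NatExpr.value, i15]
    · simp only [walkBody, cur, Program.exec, State.storeNat_nat, NatExpr.value, i15, i16, i17,
        e11, e12]
      norm_num
      rw [blockStart, blockStart, Finset.sum_range_succ]
      omega
    · intro j hj
      simp only [walkBody, cur, Program.exec, State.storeNat_nat, NatExpr.value, i15, i16, i17,
        e11, e12]
      norm_num
      by_cases hji : j = i
      · simp [hji]
      · rw [if_neg fun h => hinj i hi j (by omega) h.symm]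
        exact i18 j (by omega)

end RealRAM

/-! ### Evaluating the coordinates -/

namespace RealRAM

/-- The angle of a slot. -/
def unitExpr : RealExpr :=
  .div (.arctan (.cast (.const 1))) (.cast (.add (.load 0 (.const 0)) (.const 1)))

/-- The radius of the circle of the spine. -/
def radiusExpr : RealExpr :=
  .mul (.cast (.const 4)) (.cast (.add (.load 0 (.const 0)) (.const 1)))

/-- Half the length of the block to which the current vertex, a leaf, belongs. -/
def halfExpr : NatExpr := .add (.load 12 (.load 11 counter)) (.const 1)

/-- The expression for `leafWeight`. -/
def weightExpr : RealExpr :=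
  .div (.cast (.const 2)) (.mul (.sin (.mul (.cast halfExpr) unitExpr))
    (.sin (.div unitExpr (.cast (.const 2)))))

/-- The weight times the cosine of the angle of `e + 1 / 2` slots. -/
def weightedCosExpr (e : NatExpr) : RealExpr :=
  .mul weightExpr
    (.cos (.mul (.add (.cast e) (.div (.cast (.const 1)) (.cast (.const 2)))) unitExpr))

/-- The expression for `leafRadius`. -/
def leafRadiusExpr : RealExpr :=
  .div (.sub (.sqrt (.add
      (.mul (weightedCosExpr (.load 13 counter)) (weightedCosExpr (.load 13 counter)))
      (.mul (.cast (.const 4)) (.add (.cast (.const 1)) (weightedCosExpr halfExpr)))))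
    (weightedCosExpr (.load 13 counter))) (.cast (.const 2))

/-- Compute slot and polar radius of the current vertex. -/
def polarBody : Program :=
  .ite (.natEq (.load 7 counter) (.const 1))
    (.seq (.setNat 19 counter (.load 18 counter)) (.setReal 2 counter (.cast (.const 1))))
    (.seq (.setNat 19 counter
        (.add (.add (.load 18 (.load 11 counter)) halfExpr) (.load 13 counter)))
      (.setReal 2 counter leafRadiusExpr))

/-- The angle of the current vertex. -/
def angleExpr : RealExpr := .mul (.cast (.load 19 counter)) unitExpr

/-- Compute the coordinates of the current vertex. -/
def coordBody : Program :=
  .seq polarBody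
    (.seq (.setReal 0 counter (.sub (.cast (.const 0))
        (.mul (.mul radiusExpr (.load 2 counter)) (.cos angleExpr))))
      (.setReal 1 counter (.mul (.mul radiusExpr (.load 2 counter)) (.sin angleExpr))))

/-- The angle of a slot in a layout of `n` vertices. -/
noncomputable def slotAngle (n : ℕ) : ℝ := Real.pi / (4 * (n + 1))

/-- Real constants are limited to natural numbers, so `π / 4` is obtained as `arctan 1`. -/
theorem unitExpr_value (s : State) : unitExpr.value s = slotAngle (s.nat 0 0) := by
  simp only [unitExpr, RealExpr.value, NatExpr.value, Nat.cast_one, Real.arctan_one, slotAngle]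
  push_cast
  rw [div_div]

theorem radiusExpr_value (s : State) : radiusExpr.value s = 4 * (s.nat 0 0 + 1) := by
  simp [radiusExpr, RealExpr.value, NatExpr.value]

theorem leafRadiusExpr_value (s : State) : leafRadiusExpr.value s =
    leafRadius (slotAngle (s.nat 0 0)) ((s.nat 12 (s.nat 11 (s.nat 10 0)) + 1 : ℕ) : ℝ)
      (s.nat 13 (s.nat 10 0)) := by
  simp only [leafRadiusExpr, weightedCosExpr, weightExpr, RealExpr.value, unitExpr_value, halfExpr,
    NatExpr.value, counter, leafRadius, leafWeight, sq, Nat.cast_one, Nat.cast_ofNat]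

/-- Quantifying over `p` and `r` with their defining equations lets the slot and radius of an
abstract layout be substituted directly. -/
theorem runs_coord (s₀ : State) (n : ℕ) (hn : s₀.nat 0 0 = n) :
    Runs (forLoop 0 0 coordBody) s₀ (roundCost coordBody * (n + 1)) fun s =>
      ∀ v < n, ∀ (p : ℕ) (r : ℝ),
        (s₀.nat 7 v = 1 → p = s₀.nat 18 v ∧ r = 1) →
        (s₀.nat 7 v ≠ 1 → p = s₀.nat 18 (s₀.nat 11 v) + (s₀.nat 12 (s₀.nat 11 v) + 1) +
          s₀.nat 13 v ∧ r = leafRadius (slotAngle n) ((s₀.nat 12 (s₀.nat 11 v) + 1 : ℕ) : ℝ)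
            (s₀.nat 13 v)) →
        s.real 0 v = -(4 * (n + 1) * r * Real.cos (p * slotAngle n)) ∧
        s.real 1 v = 4 * (n + 1) * r * Real.sin (p * slotAngle n) := by
  have := runs_forLoop (c := 0) (j := 0) (body := coordBody)
    ⟨⟨⟨trivial, trivial⟩, trivial, trivial⟩, trivial, trivial⟩
    (by decide) (by decide) (by decide)
    (fun i s => ∀ v < i, ∀ (p : ℕ) (r : ℝ),
        (s₀.nat 7 v = 1 → p = s₀.nat 18 v ∧ r = 1) →
        (s₀.nat 7 v ≠ 1 → p = s₀.nat 18 (s₀.nat 11 v) + (s₀.nat 12 (s₀.nat 11 v) + 1) +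
          s₀.nat 13 v ∧ r = leafRadius (slotAngle n) ((s₀.nat 12 (s₀.nat 11 v) + 1 : ℕ) : ℝ)
            (s₀.nat 13 v)) →
        s.real 0 v = -(4 * (n + 1) * r * Real.cos (p * slotAngle n)) ∧
        s.real 1 v = 4 * (n + 1) * r * Real.sin (p * slotAngle n)) s₀ ?_ ?_
  · rw [hn] at this
    exact this.mono fun s hs => hs.2
  · intro v hv
    exact absurd hv (Nat.not_lt_zero _)
  · intro i s hi hcount hframe hinv v hv p r h1 h2
    have e0 := hframe 0 (by decide) (by decide)
    have e7 := hframe 7 (by decide) (by decide)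
    have e11 := hframe 11 (by decide) (by decide)
    have e12 := hframe 12 (by decide) (by decide)
    have e13 := hframe 13 (by decide) (by decide)
    have e18 := hframe 18 (by decide) (by decide)
    have hpolar : ∃ (p' : ℕ) (r' : ℝ),
        polarBody.exec s = (s.storeNat 19 i p').storeReal 2 i r' ∧ (v = i → p' = p ∧ r' = r) := by
      by_cases c : s₀.nat 7 i = 1
      · refine ⟨s₀.nat 18 i, 1, ?_, ?_⟩
        · rw [polarBody, Program.exec_ite_pos]
          · simp [Program.exec, counter, NatExpr.value, RealExpr.value, hcount, e18,
              State.storeNat_nat]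
          · simpa [Test.Holds, counter, NatExpr.value, hcount, e7] using c
        · rintro rfl
          obtain ⟨rfl, rfl⟩ := h1 c
          exact ⟨rfl, rfl⟩
      · refine ⟨s₀.nat 18 (s₀.nat 11 i) + (s₀.nat 12 (s₀.nat 11 i) + 1) + s₀.nat 13 i,
          leafRadius (slotAngle n) ((s₀.nat 12 (s₀.nat 11 i) + 1 : ℕ) : ℝ) (s₀.nat 13 i), ?_, ?_⟩
        · rw [polarBody, Program.exec_ite_neg]
          · simp only [Program.exec, leafRadiusExpr_value, counter, NatExpr.value, halfExpr,
              State.storeNat_nat, hcount, e0, e11, e12, e13, e18, hn]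
            norm_num
          · simpa [Test.Holds, counter, NatExpr.value, hcount, e7] using c
        · rintro rfl
          obtain ⟨rfl, rfl⟩ := h2 c
          exact ⟨rfl, rfl⟩
    obtain ⟨p', r', he, hv'⟩ := hpolar
    simp only [coordBody, angleExpr, Program.exec, he, counter, NatExpr.value, RealExpr.value,
      unitExpr_value, radiusExpr_value, State.storeNat_nat, State.storeReal_nat,
      State.storeReal_real, State.storeNat_real, hcount, e0, hn]
    norm_num
    by_cases hvi : v = i
    · obtain ⟨rfl, rfl⟩ := hv' hvi
      simp [hvi]
    · simp only [hvi, if_false]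
      exact hinv v (by omega) p r h1 h2

/-! ### The complete program -/

theorem Runs.mono_cost {p : Program} {s : State} {b c : ℕ} {Q : State → Prop} (h : Runs p s b Q)
    (hbc : b ≤ c) : Runs p s c Q := by
  obtain ⟨t, s', h1, h2, h3⟩ := h
  exact ⟨t, s', h1, h2.trans hbc, h3⟩

theorem Runs.seq_mul {p q : Program} {s : State} {b c N : ℕ} {Q Q' : State → Prop}
    (h : Runs p s (b * N) Q) (h' : ∀ s', Q s' → Runs q s' (c * N) Q') :
    Runs (.seq p q) s ((b + c) * N) Q' := by
  rw [add_mul]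
  exact h.seq h'

/-- Prepare the walk along the spine. -/
def initBody : Program :=
  .seq (.setNat 15 (.const 0) (.load 14 (.const 0))) (.setNat 17 (.const 0) (.const 1))

/-- The drawing program. -/
def drawProgram : Program :=
  .seq (forLoop 0 0 onesBody) (.seq (forLoop 0 2 (accBody 6 5)) (.seq (forLoop 0 0 flagBody)
    (.seq (forLoop 0 2 (accBody 9 7)) (.seq (forLoop 0 2 (accBody 11 8))
    (.seq (forLoop 0 0 indexBody) (.seq initBody (.seq (forLoop 21 0 walkBody)
    (forLoop 0 0 coordBody))))))))

/-- A bound for the number of steps per vertex and edge. -/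
def drawCost : ℕ :=
  roundCost onesBody + (roundCost (accBody 6 5) + (roundCost flagBody +
    (roundCost (accBody 9 7) + (roundCost (accBody 11 8) + (roundCost indexBody +
    (initBody.maxCost + (roundCost walkBody + roundCost coordBody)))))))

/-- The end of the spine selected depends on the numbering, so the walk is assumed to exist from
every possible end, and the selected end `v` and the table `b` of block starts are returned
existentially. -/
theorem runs_draw (s₀ : State) (n m k : ℕ) (A B flag sd nb cnt : ℕ → ℕ)
    (hn : s₀.nat 0 0 = n) (hm : s₀.nat 0 2 = m) (hA : s₀.nat 3 = A) (hB : s₀.nat 4 = B)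
    (h0 : ∀ a, 5 ≤ a → s₀.nat a = fun _ => 0)
    (hflag : ∀ v, flag v = if v < n ∧
      (edgeSum m A B (fun v => if v < n then 1 else 0) v ≠ 1 ∨ n + v = 2) then 1 else 0)
    (hk : k = ∑ v ∈ Finset.range n, flag v) (hkn : k ≤ n)
    (hsd : sd = edgeSum m A B flag)
    (hnb : nb = edgeSum m A B (fun v => if flag v = 1 then v else 0))
    (hcnt : cnt = leafCount flag nb n)
    (hstart : ∃ v < n, flag v = 1 ∧ sd v < 2)
    (hwalk : ∀ v < n, flag v = 1 → sd v < 2 → ∃ u : ℕ → ℕ, u 0 = v ∧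
      (∀ i, i + 1 < k → u (i + 1) = nb (u i) - if i = 0 then 0 else u (i - 1)) ∧
      (∀ i < k, ∀ j < i, u i ≠ u j)) :
    Runs drawProgram s₀ (drawCost * (n + m + 1)) fun s => ∃ (v : ℕ) (b : ℕ → ℕ),
      v < n ∧ flag v = 1 ∧ sd v < 2 ∧
      (∀ u : ℕ → ℕ, u 0 = v →
        (∀ i, i + 1 < k → u (i + 1) = nb (u i) - if i = 0 then 0 else u (i - 1)) →
        ∀ i < k, b (u i) = blockStart cnt u i) ∧
      ∀ v < n, ∀ (p : ℕ) (r : ℝ),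
        (flag v = 1 → p = b v ∧ r = 1) →
        (flag v ≠ 1 → p = b (nb v) + (cnt (nb v) + 1) + leafCount flag nb v (nb v) ∧
          r = leafRadius (slotAngle n) ((cnt (nb v) + 1 : ℕ) : ℝ)
            (leafCount flag nb v (nb v))) →
        s.real 0 v = -(4 * (n + 1) * r * Real.cos (p * slotAngle n)) ∧
        s.real 1 v = 4 * (n + 1) * r * Real.sin (p * slotAngle n) := by
  unfold drawProgram drawCost
  -- weights one
  refine Runs.seq_mul ((runs_ones s₀ (h0 5 le_rfl)).mono_cost
    (Nat.mul_le_mul_left _ (by omega))) ?_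
  rintro s₁ ⟨f1, ones⟩
  rw [hn] at ones
  -- degrees
  refine Runs.seq_mul ((runs_acc (by decide) (by decide) (by decide) (by decide) (by decide)
    (by decide) s₁ (by rw [f1 6 (by decide) (by decide), h0 6 (by decide)])).mono_cost
    (Nat.mul_le_mul_left _ (by rw [f1 0 (by decide) (by decide)]; omega))) ?_
  rintro s₂ ⟨f2, deg⟩
  rw [f1 0 (by decide) (by decide), f1 3 (by decide) (by decide), f1 4 (by decide) (by decide),
    hm, hA, hB, ones] at deg
  have g2 : ∀ a, a ∉ [5, 6, 10] → s₂.nat a = s₀.nat a := by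
    intro a ha
    simp only [List.mem_cons, List.not_mem_nil, or_false, not_or] at ha
    rw [f2 a ha.2.2 (by simpa [accBody, Program.writes] using ha.2.1),
      f1 a ha.2.2 (by simpa [onesBody, Program.writes] using ha.1)]
  clear f1 f2 ones
  -- spine vertices
  refine Runs.seq_mul ((runs_flag s₂ (by rw [g2 7 (by decide), h0 7 (by decide)])
    (by rw [g2 8 (by decide), h0 8 (by decide)])
    (by rw [g2 21 (by decide), h0 21 (by decide)]) flag ?_).mono_cost
    (Nat.mul_le_mul_left _ (by rw [g2 0 (by decide)]; omega))) ?_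
  · rw [g2 0 (by decide), hn, deg]
    exact hflag
  rintro s₃ ⟨f3, flag3, fid3, k3⟩
  rw [g2 0 (by decide), hn, ← hk] at k3
  have g3 : ∀ a, a ∉ [5, 6, 7, 8, 10, 21] → s₃.nat a = s₀.nat a := by
    intro a ha
    simp only [List.mem_cons, List.not_mem_nil, or_false, not_or] at ha
    rw [f3 a (by tauto) (by simp [flagBody, markBody, Program.writes]; tauto),
      g2 a (by simp; tauto)]
  clear f3 g2 deg
  -- number of neighbours on the spine
  refine Runs.seq_mul ((runs_acc (by decide) (by decide) (by decide) (by decide) (by decide)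
    (by decide) s₃ (by rw [g3 9 (by decide), h0 9 (by decide)])).mono_cost
    (Nat.mul_le_mul_left _ (by rw [g3 0 (by decide)]; omega))) ?_
  rintro s₄ ⟨f4, sd4⟩
  rw [g3 0 (by decide), g3 3 (by decide), g3 4 (by decide), hm, hA, hB, flag3, ← hsd] at sd4
  have flag4 : s₄.nat 7 = flag := by rw [f4 7 (by decide) (by decide), flag3]
  have fid4 : s₄.nat 8 = fun v => if flag v = 1 then v else 0 := by
    rw [f4 8 (by decide) (by decide), fid3]
  have k4 : s₄.nat 21 0 = k := by rw [f4 21 (by decide) (by decide), k3]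
  have g4 : ∀ a, a ∉ [5, 6, 7, 8, 9, 10, 21] → s₄.nat a = s₀.nat a := by
    intro a ha
    simp only [List.mem_cons, List.not_mem_nil, or_false, not_or] at ha
    rw [f4 a (by tauto) (by simp [accBody, Program.writes]; tauto), g3 a (by simp; tauto)]
  clear f4 g3 flag3 fid3 k3
  -- sum of the neighbours on the spine
  refine Runs.seq_mul ((runs_acc (by decide) (by decide) (by decide) (by decide) (by decide)
    (by decide) s₄ (by rw [g4 11 (by decide), h0 11 (by decide)])).mono_cost
    (Nat.mul_le_mul_left _ (by rw [g4 0 (by decide)]; omega))) ?_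
  rintro s₅ ⟨f5, nb5⟩
  rw [g4 0 (by decide), g4 3 (by decide), g4 4 (by decide), hm, hA, hB, fid4, ← hnb] at nb5
  have flag5 : s₅.nat 7 = flag := by rw [f5 7 (by decide) (by decide), flag4]
  have sd5 : s₅.nat 9 = sd := by rw [f5 9 (by decide) (by decide), sd4]
  have k5 : s₅.nat 21 0 = k := by rw [f5 21 (by decide) (by decide), k4]
  have g5 : ∀ a, a ∉ [5, 6, 7, 8, 9, 10, 11, 21] → s₅.nat a = s₀.nat a := by
    intro a ha
    simp only [List.mem_cons, List.not_mem_nil, or_false, not_or] at ha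
    rw [f5 a (by tauto) (by simp [accBody, Program.writes]; tauto), g4 a (by simp; tauto)]
  clear f5 g4 flag4 fid4 sd4 k4
  -- leaves
  refine Runs.seq_mul ((runs_index s₅ (by rw [g5 12 (by decide), h0 12 (by decide)]) flag nb flag5
    nb5).mono_cost (Nat.mul_le_mul_left _ (by rw [g5 0 (by decide)]; omega))) ?_
  rintro s₆ ⟨f6, cnt6, idx6, start6⟩
  rw [g5 0 (by decide), hn] at cnt6 idx6 start6
  rw [sd5] at start6
  rw [← hcnt] at cnt6
  obtain ⟨hv1, hv2, hv3⟩ := start6 hstart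
  have flag6 : s₆.nat 7 = flag := by rw [f6 7 (by decide) (by decide), flag5]
  have nb6 : s₆.nat 11 = nb := by rw [f6 11 (by decide) (by decide), nb5]
  have k6 : s₆.nat 21 0 = k := by rw [f6 21 (by decide) (by decide), k5]
  have z6 : s₆.nat 16 0 = 0 := by
    rw [f6 16 (by decide) (by decide), g5 16 (by decide), h0 16 (by decide)]
  have n6 : s₆.nat 0 0 = n := by rw [f6 0 (by decide) (by decide), g5 0 (by decide), hn]
  clear f6 g5 flag5 sd5 k5 nb5
  -- the walk
  refine Runs.seq_mul (Q := fun s => s = initBody.exec s₆) ((runs_of_loopFree (p := initBody)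
    (Q := fun s => s = initBody.exec s₆) ⟨trivial, trivial⟩ rfl).mono_cost (Nat.le_mul_of_pos_right _ (show 0 < n + m + 1 by omega))) ?_
  rintro s₇ hs₇
  have g7 : ∀ a, a ≠ 15 → a ≠ 17 → s₇.nat a = s₆.nat a := by
    intro a h1 h2
    rw [hs₇]
    exact initBody.exec_nat_of_notMem s₆ a (by simp [initBody, Program.writes, h1, h2])
  have c15 : s₇.nat 15 0 = s₆.nat 14 0 := by
    rw [hs₇]
    simp [initBody, Program.exec, State.storeNat_nat, NatExpr.value]
  have c17 : s₇.nat 17 0 = 1 := by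
    rw [hs₇]
    simp [initBody, Program.exec, State.storeNat_nat, NatExpr.value]
  obtain ⟨u, hu0, hu1, hu2⟩ := hwalk _ hv1 hv2 hv3
  refine Runs.seq_mul ((runs_walk s₇ nb cnt u k (by rw [g7 21 (by decide) (by decide), k6])
    (by rw [g7 11 (by decide) (by decide), nb6]) (by rw [g7 12 (by decide) (by decide), cnt6])
    (by rw [c15, hu0]) (by rw [g7 16 (by decide) (by decide), z6]) c17 hu1 hu2).mono_cost
    (Nat.mul_le_mul_left _ (show k + 1 ≤ n + m + 1 by omega))) ?_
  rintro s₈ ⟨f8, b8⟩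
  have e : ∀ a, a ≠ 15 → a ≠ 17 → a ≠ 10 → a ∉ walkBody.writes → s₈.nat a = s₆.nat a :=
    fun a h1 h2 h3 h4 => by rw [f8 a h3 h4, g7 a h1 h2]
  refine ((runs_coord s₈ n (by
    rw [e 0 (by decide) (by decide) (by decide) (by decide), n6])).mono ?_).mono_cost
    (Nat.mul_le_mul_left _ (show n + 1 ≤ n + m + 1 by omega))
  intro s hs
  rw [e 7 (by decide) (by decide) (by decide) (by decide),
    e 11 (by decide) (by decide) (by decide) (by decide),
    e 12 (by decide) (by decide) (by decide) (by decide),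
    e 13 (by decide) (by decide) (by decide) (by decide), flag6, nb6, cnt6] at hs
  refine ⟨s₆.nat 14 0, s₈.nat 18, hv1, hv2, hv3, fun w hw0 hw1 => ?_, fun v hv p r h1 h2 => ?_⟩
  -- The recursion determines the walk from its first vertex.
  · have hwu : ∀ i, i < k → w i = u i := by
      intro i
      induction i using Nat.strong_induction_on with
      | _ i ih =>
        intro hi
        cases i with
        | zero => rw [hw0, hu0]
        | succ i =>
          rw [hw1 i hi, hu1 i hi, ih i (by omega) (by omega)]
          split_ifs
          · rfl
          · rw [ih (i - 1) (by omega) (by omega)]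
    intro i hi
    rw [hwu i hi, b8 i hi, blockStart, blockStart]
    congr 1
    refine Finset.sum_congr rfl fun j hj => ?_
    rw [hwu j ((Finset.mem_range.1 hj).trans hi)]
  · refine hs v hv p r h1 fun hf => ?_
    rw [idx6 v hv hf]
    exact h2 hf

end RealRAM

/-! ## Edge lists -/

-- Each edge of `S` is listed once and is no loop, so scanning both ends of all listed edges visits
-- every neighbour of `v` exactly once.
open Classical in
theorem edgeSum_eq {n : ℕ} {S : SimpleGraph (Fin n)} {W : List (Fin n × Fin n)}
    (hW : IsEdgeList S W) (f : ℕ → ℕ) (v : Fin n) :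
    edgeSum W.length (fun i => (W.map fun e => (e.1 : ℕ)).getD i 0)
      (fun i => (W.map fun e => (e.2 : ℕ)).getD i 0) f v =
      ∑ w ∈ Finset.univ.filter (S.Adj v), f w := by
  -- The contribution of one undirected edge to the sum at `v`; it does not depend on the order of
  -- the ends.
  set g : Sym2 (Fin n) → ℕ := fun z => ∑ w : Fin n, if z = s(v, w) then f w else 0 with hg
  have h1 : edgeSum W.length (fun i => (W.map fun e => (e.1 : ℕ)).getD i 0)
      (fun i => (W.map fun e => (e.2 : ℕ)).getD i 0) f v =
      ((W.map fun e => s(e.1, e.2)).map g).sum := by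
    rw [List.map_map, ← Fin.sum_univ_fun_getElem, edgeSum, Finset.sum_range]
    refine Finset.sum_congr rfl fun i _ => ?_
    have hadj : S.Adj W[i].1 W[i].2 := by
      rw [← hW.2]
      exact List.mem_map_of_mem (List.getElem_mem i.2)
    have hne := hadj.ne
    simp only [Function.comp, hg, Fin.getElem_fin, List.getD_eq_getElem?_getD, List.getElem?_map,
      List.getElem?_eq_getElem i.2, Option.map_some, Option.getD_some, Fin.val_inj] at hne ⊢
    set a := W[(i : ℕ)].1
    set b := W[(i : ℕ)].2
    have : ∀ w : Fin n, (if s(a, b) = s(v, w) then f w else 0) =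
        (if b = w then if a = v then f w else 0 else 0) +
          (if a = w then if b = v then f w else 0 else 0) := by
      intro w
      simp only [Sym2.eq_iff]
      grind
    simp only [this, Finset.sum_add_distrib, Finset.sum_ite_eq, Finset.mem_univ, if_true]
  rw [h1, ← List.sum_toFinset g hW.1]
  simp only [hg]
  rw [Finset.sum_comm, Finset.sum_filter]
  refine Finset.sum_congr rfl fun w _ => ?_
  rw [Finset.sum_ite_eq']
  simp only [List.mem_toFinset, hW.2]

theorem length_eq_ncard {n : ℕ} {S : SimpleGraph (Fin n)} {W : List (Fin n × Fin n)}
    (hW : IsEdgeList S W) : W.length = S.edgeSet.ncard := by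
  classical
  rw [← List.length_map (fun e => s(e.1, e.2)), ← List.toFinset_card_of_nodup hW.1,
    ← Set.ncard_coe_finset]
  congr 1
  ext z
  induction z using Sym2.ind with
  | _ a b => simpa using hW.2 a b

/-! ## Caterpillars -/

/-- A graph with a path `u 0, …, u (k - 1)` such that all other vertices are leaves adjacent to the
path. -/
structure IsSpine {V : Type*} (S : SimpleGraph V) (flag : V → Prop) (k : ℕ) (u : ℕ → V) :
    Prop where
  flag_apply : ∀ i < k, flag (u i)
  inj : ∀ i < k, ∀ j < k, u i = u j → i = j
  surj : ∀ v, flag v → ∃ i < k, u i = v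
  adj_iff : ∀ i < k, ∀ j < k, S.Adj (u i) (u j) ↔ i + 1 = j ∨ j + 1 = i
  leaf : ∀ v, ¬ flag v → ∃ w, flag w ∧ ∀ x, S.Adj v x ↔ x = w

namespace IsSpine

variable {V : Type*} {S : SimpleGraph V} {flag : V → Prop} {k : ℕ} {u : ℕ → V}

theorem reverse (h : IsSpine S flag k u) : IsSpine S flag k (fun i => u (k - 1 - i)) where
  flag_apply i hi := h.flag_apply _ (by omega)
  inj i hi j hj hij := by
    have := h.inj _ (by omega) _ (by omega) hij
    omega
  surj v hv := by
    obtain ⟨i, hi, rfl⟩ := h.surj v hv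
    exact ⟨k - 1 - i, by omega, by congr 1; omega⟩
  adj_iff i hi j hj := by
    rw [h.adj_iff _ (by omega) _ (by omega)]
    omega
  leaf := h.leaf

open Classical in
theorem sum_adj [Fintype V] (h : IsSpine S flag k u) (v : V) (g : V → ℕ) :
    (∑ w ∈ Finset.univ.filter (S.Adj v), if flag w then g w else 0) =
      ∑ j ∈ Finset.range k, if S.Adj v (u j) then g (u j) else 0 := by
  have himage : Finset.univ.filter flag = (Finset.range k).image u := by
    ext w
    simp only [Finset.mem_filter, Finset.mem_univ, true_and, Finset.mem_image, Finset.mem_range]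
    constructor
    · exact h.surj w
    · rintro ⟨i, hi, rfl⟩
      exact h.flag_apply i hi
  rw [← Finset.sum_image (f := fun w => if S.Adj v w then g w else 0)
    (fun i hi j hj hij => h.inj i (Finset.mem_range.1 hi) j (Finset.mem_range.1 hj) hij),
    ← himage, Finset.sum_filter, Finset.sum_filter]
  refine Finset.sum_congr rfl fun w _ => ?_
  split_ifs <;> rfl

-- A vertex of a path has only its successor and predecessor as path neighbours. With `g = 1` this
-- counts spine neighbours, and with `g` the vertex name it gives the sum used in the walk.
open Classical in
theorem sum_adj_apply [Fintype V] (h : IsSpine S flag k u) {i : ℕ} (hi : i < k) (g : V → ℕ) :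
    (∑ w ∈ Finset.univ.filter (S.Adj (u i)), if flag w then g w else 0) =
      (if i + 1 < k then g (u (i + 1)) else 0) + if i = 0 then 0 else g (u (i - 1)) := by
  rw [h.sum_adj]
  have : ∀ j ∈ Finset.range k, (if S.Adj (u i) (u j) then g (u j) else 0) =
      (if i + 1 = j then g (u j) else 0) +
        (if i - 1 = j then if i = 0 then 0 else g (u j) else 0) := by
    intro j hj
    rw [Finset.mem_range] at hj
    simp only [h.adj_iff i hi j hj]
    split_ifs <;> omega
  rw [Finset.sum_congr rfl this, Finset.sum_add_distrib, Finset.sum_ite_eq, Finset.sum_ite_eq]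
  simp only [Finset.mem_range, show i - 1 < k by omega, if_true]

theorem exists_start (h : IsSpine S flag k u) {v : V} (hv : ∃ i < k, u i = v ∧ (i = 0 ∨ i + 1 = k)) :
    ∃ u' : ℕ → V, u' 0 = v ∧ IsSpine S flag k u' := by
  obtain ⟨i, hi, rfl, rfl | hik⟩ := hv
  · exact ⟨u, rfl, h⟩
  · exact ⟨_, by simp only [Nat.sub_zero]; congr 1; omega, h.reverse⟩

end IsSpine

/-- A walk starting on an edge between two leaves can never leave it, so by connectedness that edge
is the whole graph. -/
theorem eq_or_eq_of_leaves_adj {V : Type*} {S : SimpleGraph V} (hS : S.Connected) {v w : V}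
    (hv : IsLeafOf S v) (hw : IsLeafOf S w) (h : S.Adj v w) (x : V) : x = v ∨ x = w := by
  have key : ∀ {a b : V}, S.Walk a b → (a = v ∨ a = w) → (b = v ∨ b = w) := by
    intro a b p
    induction p with
    | nil => exact id
    | cons hab _ ih =>
      rintro (rfl | rfl)
      · exact ih (Or.inr (hv.unique hab h))
      · exact ih (Or.inl (hw.unique hab h.symm))
  obtain ⟨p⟩ := hS.preconnected v x
  exact key p (Or.inl rfl)

/-- The spine of a caterpillar; if the caterpillar is a single edge, one of its ends is taken as the
spine. -/
theorem IsCaterpillar.exists_isSpine {n : ℕ} {S : SimpleGraph (Fin n)} (hS : IsCaterpillar S) :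
    ∃ (k : ℕ) (u : ℕ → Fin n), 0 < k ∧
      IsSpine S (fun v => ¬ IsLeafOf S v ∨ n + v = 2) k u ∧ (n = 2 → ∀ v, IsLeafOf S v) := by
  obtain ⟨hT, k, ⟨e⟩⟩ := hS
  have hconn := hT.connected
  have hpos : 0 < n := Fin.pos_iff_nonempty.2 hconn.nonempty
  by_cases hn : n = 2
  · subst hn
    have h01 : S.Adj 0 1 := by
      obtain ⟨p⟩ := hconn.preconnected 0 1
      cases p with
      | cons h q =>
        rename_i x
        fin_cases x
        · exact absurd rfl h.ne
        · exact h
    have hadj : ∀ v x : Fin 2, S.Adj v x ↔ v ≠ x := by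
      intro v x
      fin_cases v <;> fin_cases x <;> simp [h01, h01.symm]
    have hleaf : ∀ v, IsLeafOf S v := by
      intro v
      fin_cases v
      · exact ⟨1, h01, fun x hx => by fin_cases x; exacts [absurd rfl hx.ne, rfl]⟩
      · exact ⟨0, h01.symm, fun x hx => by fin_cases x; exacts [rfl, absurd rfl hx.ne]⟩
    refine ⟨1, fun _ => 0, one_pos, ⟨?_, ?_, ?_, ?_, ?_⟩, fun _ => hleaf⟩
    · intro i _
      right
      rfl
    · intro i hi j hj _
      omega
    · rintro v (hv | hv)
      · exact absurd (hleaf v) hv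
      · exact ⟨0, one_pos, Fin.ext (by simp; omega)⟩
    · intro i hi j hj
      simp
      omega
    · intro v hv
      refine ⟨0, Or.inr rfl, fun x => ?_⟩
      have hv1 : v = 1 := by
        fin_cases v
        · exact absurd (Or.inr rfl) hv
        · rfl
      subst hv1
      rw [hadj]
      fin_cases x <;> simp
  -- For `n ≠ 2`, `n + v = 2` could hold only with `n = v = 1`, which `v < n` excludes.
  · have hflag : ∀ v : Fin n, (¬ IsLeafOf S v ∨ n + v = 2) ↔ v ∈ spineSet S := by
      intro v
      simp only [spineSet, Set.mem_ofPred_eq, or_iff_left_iff_imp]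
      intro h hv
      have h0 : n = 1 ∧ (v : ℕ) = 1 := by omega
      have := v.2
      omega
    have hnot : ∀ v w, IsLeafOf S v → S.Adj v w → w ∈ spineSet S := by
      intro v w hv hvw hw
      have hall := eq_or_eq_of_leaves_adj hconn hv hw hvw
      have : (Finset.univ : Finset (Fin n)) = {v, w} := by
        ext x
        simp [hall x]
      have hc := congrArg Finset.card this
      rw [Finset.card_univ, Fintype.card_fin, Finset.card_pair hvw.ne] at hc
      exact hn hc
    have hk : 0 < k := by
      have : (spineSet S).Nonempty := by
        by_cases h : IsLeafOf S ⟨0, hpos⟩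
        · obtain ⟨w, hw, -⟩ := id h
          exact ⟨w, hnot _ w h hw⟩
        · exact ⟨_, h⟩
      obtain ⟨v, hv⟩ := this
      exact (Nat.zero_le _).trans_lt (e ⟨v, hv⟩).2
    refine ⟨k, fun i => if h : i < k then (e.symm ⟨i, h⟩ : spineSet S) else ⟨0, hpos⟩, hk,
      ⟨?_, ?_, ?_, ?_, ?_⟩, fun h => absurd h hn⟩
    · intro i hi
      rw [hflag, dif_pos hi]
      exact (e.symm ⟨i, hi⟩).2
    · intro i hi j hj hij
      rw [dif_pos hi, dif_pos hj] at hij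
      have := e.symm.injective (Subtype.ext hij)
      simpa using this
    · intro v hv
      rw [hflag] at hv
      refine ⟨e ⟨v, hv⟩, (e ⟨v, hv⟩).2, ?_⟩
      simp
    · intro i hi j hj
      rw [dif_pos hi, dif_pos hj]
      have := e.symm.map_adj_iff (v := ⟨i, hi⟩) (w := ⟨j, hj⟩)
      rw [SimpleGraph.comap_adj, SimpleGraph.pathGraph_adj] at this
      exact this
    · intro v hv
      rw [not_or, not_not] at hv
      obtain ⟨w, hw, hw'⟩ := id hv.1
      exact ⟨w, (hflag w).2 (hnot v w hv.1 hw), fun x => ⟨hw' x, fun h => h ▸ hw⟩⟩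

/-! ## Numbering the leaves -/

theorem leafCount_lt {flag nb : ℕ → ℕ} {v i : ℕ} (hvi : v < i) (hv : flag v ≠ 1) :
    leafCount flag nb v (nb v) < leafCount flag nb i (nb v) := by
  refine Finset.card_lt_card (Finset.ssubset_iff_subset_ne.2 ⟨?_, fun h => ?_⟩)
  · exact Finset.filter_subset_filter _ (Finset.range_subset_range.2 hvi.le)
  · have : v ∈ (Finset.range i).filter fun w => flag w ≠ 1 ∧ nb w = nb v := by
      simp [hvi, hv]
    rw [← h] at this
    simp at this

theorem leafCount_add_one_le {flag nb : ℕ → ℕ} {n v : ℕ} (hv : v < n) (hf : flag v = 1) (u : ℕ) :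
    leafCount flag nb n u + 1 ≤ n := by
  have : (Finset.range n).filter (fun w => flag w ≠ 1 ∧ nb w = u) ⊆ (Finset.range n).erase v := by
    intro w hw
    simp only [Finset.mem_filter, Finset.mem_erase] at hw ⊢
    exact ⟨fun h => hw.2.1 (h ▸ hf), hw.1⟩
  have := Finset.card_le_card this
  rw [Finset.card_erase_of_mem (Finset.mem_range.2 hv), Finset.card_range] at this
  rw [leafCount]
  omega

/-- The stars formed by a spine vertex and its leaves are disjoint subsets of the `n` vertices. This
bounds the total length of the blocks. -/
theorem sum_leafCount_le {flag nb u : ℕ → ℕ} {n k : ℕ} (hu : ∀ i < k, u i < n ∧ flag (u i) = 1)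
    (hinj : ∀ i < k, ∀ j < k, u i = u j → i = j) :
    ∑ i ∈ Finset.range k, (leafCount flag nb n (u i) + 1) ≤ n := by
  set D : ℕ → Finset ℕ := fun i =>
    insert (u i) ((Finset.range n).filter fun w => flag w ≠ 1 ∧ nb w = u i) with hD
  have hcard : ∀ i ∈ Finset.range k, leafCount flag nb n (u i) + 1 = (D i).card := by
    intro i hi
    rw [hD, Finset.card_insert_of_notMem, leafCount]
    simp [(hu i (Finset.mem_range.1 hi)).2]
  rw [Finset.sum_congr rfl hcard, ← Finset.card_biUnion]
  · have : (Finset.range k).biUnion D ⊆ Finset.range n := by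
      intro w hw
      simp only [hD, Finset.mem_biUnion, Finset.mem_insert, Finset.mem_filter] at hw
      obtain ⟨i, hi, rfl | h⟩ := hw
      · exact Finset.mem_range.2 (hu i (Finset.mem_range.1 hi)).1
      · exact h.1
    simpa using Finset.card_le_card this
  · intro i hi j hj hij
    have hi := Finset.mem_range.1 hi
    have hj := Finset.mem_range.1 hj
    rw [Function.onFun, Finset.disjoint_left]
    intro w h1 h2
    simp only [hD, Finset.mem_insert, Finset.mem_filter] at h1 h2
    have h3 := (hu i hi).2
    have h4 := (hu j hj).2
    rcases h1 with rfl | h1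
    · rcases h2 with h2 | h2
      · exact hij (hinj i hi j hj h2)
      · exact h2.2.1 h3
    · rcases h2 with rfl | h2
      · exact h1.2.1 h4
      · exact hij (hinj i hi j hj (h1.2.2.symm.trans h2.2.2))

theorem blockStart_succ (cnt u : ℕ → ℕ) (i : ℕ) :
    RealRAM.blockStart cnt u (i + 1) = RealRAM.blockStart cnt u i + 2 * (cnt (u i) + 1) := by
  rw [RealRAM.blockStart, RealRAM.blockStart, Finset.sum_range_succ, add_assoc]

theorem blockStart_mono (cnt u : ℕ → ℕ) : Monotone (RealRAM.blockStart cnt u) :=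
  monotone_nat_of_le_succ fun i => by
    rw [blockStart_succ]
    omega

/-- The layout given by a spine and a table of block starts. -/
theorem exists_blockLayout {n : ℕ} {S : SimpleGraph (Fin n)} {spine : Fin n → Prop} {k : ℕ}
    {u : ℕ → Fin n} (h : IsSpine S spine k u) (hk : 0 < k) {flag nb cnt b : ℕ → ℕ}
    (hflag : ∀ v : Fin n, flag v = 1 ↔ spine v)
    (hnb : ∀ v w : Fin n, ¬ spine v → S.Adj v w → nb v = w)
    (hcnt : cnt = leafCount flag nb n)
    (hb : ∀ i < k, b (u i) = RealRAM.blockStart cnt (fun i => u i) i) :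
    ∃ l : BlockLayout (Fin n), l.n = n ∧ l.spine = spine ∧
      (∀ v w, ¬ spine v → S.Adj v w → l.par v = w) ∧
      (∀ v, spine v → l.slot v = b v) ∧
      (∀ v, ¬ spine v → l.slot v = b (nb v) + (cnt (nb v) + 1) + leafCount flag nb v (nb v)) ∧
      (∀ v, ¬ spine v → l.rad v = leafRadius (RealRAM.slotAngle n) ((cnt (nb v) + 1 : ℕ) : ℝ)
        (leafCount flag nb v (nb v))) ∧
      (∀ i, i + 1 < k → l.start (u (i + 1)) = l.start (u i) + 2 * l.half (u i)) := by
  choose! par hpar using h.leaf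
  have hnbp : ∀ v, ¬ spine v → nb v = par v := fun v hv =>
    hnb v _ hv (((hpar v hv).2 _).2 rfl)
  have hu : ∀ i < k, (u i : ℕ) < n ∧ flag (u i) = 1 :=
    fun i hi => ⟨(u i).2, (hflag _).2 (h.flag_apply i hi)⟩
  have hinj : ∀ i < k, ∀ j < k, (u i : ℕ) = u j → i = j :=
    fun i hi j hj hij => h.inj i hi j hj (Fin.ext hij)
  have hsum : RealRAM.blockStart cnt (fun i => u i) k ≤ 2 * n + 1 := by
    have := sum_leafCount_le (nb := nb) (u := fun i => u i) hu hinj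
    rw [RealRAM.blockStart, ← Finset.mul_sum, hcnt]
    omega
  -- There is at least one spine vertex, and it is never counted as a leaf.
  have hle : ∀ v, cnt v + 1 ≤ n := by
    rw [hcnt]
    exact leafCount_add_one_le (hu 0 hk).1 (hu 0 hk).2
  have hnext : ∀ i j, i < j → j ≤ k → RealRAM.blockStart cnt (fun i => u i) i +
      2 * (cnt (u i) + 1) ≤ RealRAM.blockStart cnt (fun i => u i) j := by
    intro i j hij hj
    have := blockStart_mono cnt (fun i => (u i : ℕ)) (Nat.succ_le_of_lt hij)
    rwa [Nat.succ_eq_add_one, blockStart_succ] at this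
  refine ⟨{ n := n
            spine := spine
            par := par
            start := fun v => b v
            half := fun v => cnt v + 1
            idx := fun v => leafCount flag nb v (nb v)
            half_pos := fun v => by omega
            half_le := fun v => hle v
            start_pos := ?_
            start_le := ?_
            disjoint := ?_
            spine_par := fun v hv => (hpar v hv).1
            idx_lt := ?_
            idx_inj := ?_ }, rfl, rfl, ?_, ?_, ?_, ?_, ?_⟩
  · intro v hv
    obtain ⟨i, hi, rfl⟩ := h.surj v hv
    rw [hb i hi, RealRAM.blockStart]
    omega
  · intro v hv
    obtain ⟨i, hi, rfl⟩ := h.surj v hv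
    rw [hb i hi]
    exact (hnext i k hi le_rfl).trans hsum
  · intro v w hv hw hne
    obtain ⟨i, hi, rfl⟩ := h.surj v hv
    obtain ⟨j, hj, rfl⟩ := h.surj w hw
    rw [hb i hi, hb j hj]
    rcases lt_trichotomy i j with hij | rfl | hij
    · exact Or.inl (hnext i j hij hj.le)
    · exact absurd rfl hne
    · exact Or.inr (hnext j i hij hi.le)
  · intro v hv
    rw [← hnbp v hv, hcnt]
    have := leafCount_lt (nb := nb) v.2 (fun hf => hv ((hflag v).1 hf))
    omega
  · intro v w hv hw hp hi
    rw [hnbp v hv, hnbp w hw, hp] at hi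
    rcases lt_trichotomy (v : ℕ) w with hvw | hvw | hvw
    · have := leafCount_lt (nb := nb) hvw (fun hf => hv ((hflag v).1 hf))
      rw [hnbp v hv, hp] at this
      omega
    · exact Fin.ext hvw
    · have := leafCount_lt (nb := nb) hvw (fun hf => hw ((hflag w).1 hf))
      rw [hnbp w hw] at this
      omega
  · exact fun v w hv hvw => (((hpar v hv).2 w).1 hvw).symm
  · exact fun v hv => BlockLayout.slot_of_spine hv
  · intro v hv
    rw [hnbp v hv]
    refine (BlockLayout.slot_of_not_spine hv).trans ?_
    simp only [hnbp v hv]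
  · intro v hv
    rw [hnbp v hv]
    refine (BlockLayout.rad_of_not_spine hv).trans ?_
    simp only [hnbp v hv]
    rfl
  · intro i hi
    simp only
    rw [hb (i + 1) hi, hb i (by omega), blockStart_succ]

/-! ### Assembly of the theorem -/

theorem theorem2 :
    ∃ (P : RealRAM.Program) (C : ℕ),
      ∀ (n : ℕ) (G S : SimpleGraph (Fin n)), S ≤ G → IsCaterpillar S →
        ∀ L W : List (Fin n × Fin n), IsEdgeList G L → IsEdgeList S W →
          ∃ (t : ℕ) (s : RealRAM.State),
            RealRAM.Run P (inputState n L W) t s ∧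
            t ≤ C * (n + G.edgeSet.ncard) ∧
            IsCompatibleDrawing G S (outputDrawing n s) ∧
            IsQuarterCircleLayout S (outputDrawing n s) ∧
            HasUnitResolution (outputDrawing n s) ∧
            drawingArea G (outputDrawing n s) ≤ C * (n : ℝ) ^ 2 := by
  -- The first summand bounds the time; `64` bounds the area, since `(4 * (n + 1)) ^ 2 ≤ (8 * n) ^
  -- 2` for `n ≥ 1`.
  refine ⟨RealRAM.drawProgram, 2 * RealRAM.drawCost + 64, fun n G S hSG hS L W hL hW => ?_⟩
  classical
  obtain ⟨spine, hspine⟩ : ∃ spine : Fin n → Prop, spine = fun v => ¬ IsLeafOf S v ∨ n + v = 2 :=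
    ⟨_, rfl⟩
  obtain ⟨k, u, hk, hu, htwo⟩ := hS.exists_isSpine
  rw [← hspine] at hu
  set A : ℕ → ℕ := fun i => (W.map fun e => (e.1 : ℕ)).getD i 0 with hA
  set B : ℕ → ℕ := fun i => (W.map fun e => (e.2 : ℕ)).getD i 0 with hB
  set flag : ℕ → ℕ := fun v => if v < n ∧
      (edgeSum W.length A B (fun v => if v < n then 1 else 0) v ≠ 1 ∨ n + v = 2)
    then 1 else 0 with hflag
  have hdeg : ∀ v : Fin n, edgeSum W.length A B (fun v => if v < n then 1 else 0) v = 1 ↔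
      IsLeafOf S v := by
    intro v
    rw [hA, hB, edgeSum_eq hW]
    simp only [Fin.is_lt, if_true, Finset.sum_const, smul_eq_mul, mul_one, Finset.card_eq_one]
    constructor
    · rintro ⟨w, hw⟩
      have : ∀ x, S.Adj v x ↔ x = w := fun x => by
        simpa using Finset.ext_iff.1 hw x
      exact ⟨w, (this w).2 rfl, fun x hx => (this x).1 hx⟩
    · rintro ⟨w, hw, hw'⟩
      refine ⟨w, ?_⟩
      ext x
      simp only [Finset.mem_filter, Finset.mem_univ, true_and, Finset.mem_singleton]
      exact ⟨hw' x, fun h => h ▸ hw⟩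
  have hfs : ∀ v : Fin n, flag v = 1 ↔ spine v := by
    intro v
    simp only [hflag, hspine, v.2, true_and, ← hdeg v]
    split_ifs with h <;> simp [h]
  have hf01 : ∀ v : Fin n, flag v = if spine v then 1 else 0 := by
    intro v
    by_cases h : spine v
    · rw [if_pos h, (hfs v).2 h]
    · rw [if_neg h]
      have h1 : flag v ≠ 1 := fun h' => h ((hfs v).1 h')
      have h2 : flag v = 1 ∨ flag v = 0 := by
        simp only [hflag]
        split_ifs <;> simp
      omega
  set sd := edgeSum W.length A B flag with hsd
  set nb := edgeSum W.length A B (fun v => if flag v = 1 then v else 0) with hnb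
  set cnt := leafCount flag nb n with hcnt
  have hkf : k = ∑ v ∈ Finset.range n, flag v := by
    have himage : Finset.univ.filter spine = (Finset.range k).image u := by
      ext w
      simp only [Finset.mem_filter, Finset.mem_univ, true_and, Finset.mem_image, Finset.mem_range]
      constructor
      · exact hu.surj w
      · rintro ⟨i, hi, rfl⟩
        exact hu.flag_apply i hi
    rw [Finset.sum_range, Finset.sum_congr rfl fun v _ => hf01 v, Finset.sum_boole, himage,
      Finset.card_image_of_injOn]
    · simp
    · intro i hi j hj hij
      exact hu.inj i (by simpa using hi) j (by simpa using hj) hij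
  have hkn : k ≤ n := by
    have := Finset.card_le_card_of_injOn (s := Finset.range k) (t := Finset.univ) u
      (fun _ _ => Finset.mem_coe.2 (Finset.mem_univ _))
      (fun i hi j hj hij => hu.inj i (by simpa using hi) j (by simpa using hj) hij)
    simpa using this
  have hsdu : ∀ {u : ℕ → Fin n}, IsSpine S spine k u → ∀ i < k, sd (u i) =
      (if i + 1 < k then 1 else 0) + if i = 0 then 0 else 1 := by
    intro u hu i hi
    rw [hsd, hA, hB, edgeSum_eq hW, ← hu.sum_adj_apply hi (fun _ => 1)]
    exact Finset.sum_congr rfl fun w _ => hf01 w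
  have hnbu : ∀ {u : ℕ → Fin n}, IsSpine S spine k u → ∀ i < k, nb (u i) =
      (if i + 1 < k then (u (i + 1) : ℕ) else 0) + if i = 0 then 0 else (u (i - 1) : ℕ) := by
    intro u hu i hi
    rw [hnb, hA, hB, edgeSum_eq hW, ← hu.sum_adj_apply hi (fun v => (v : ℕ))]
    simp only [hfs]
  have hnbl : ∀ v w : Fin n, ¬ spine v → S.Adj v w → nb v = w := by
    intro v w hv hvw
    obtain ⟨x, hx, hx'⟩ := hu.leaf v hv
    have : Finset.univ.filter (S.Adj v) = {x} := by
      ext y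
      simp [hx']
    rw [hnb, hA, hB, edgeSum_eq hW, this, Finset.sum_singleton, if_pos ((hfs x).2 hx),
      (hx' w).1 hvw]
  -- Fewer than two spine neighbours forces index `0` or `k - 1`; in the latter case the spine is
  -- reversed.
  have hgood : ∀ v : ℕ, v < n → flag v = 1 → sd v < 2 →
      ∃ u : ℕ → Fin n, (u 0 : ℕ) = v ∧ IsSpine S spine k u := by
    intro v hv hf hs
    obtain ⟨i, hi, hiv⟩ := hu.surj ⟨v, hv⟩ ((hfs ⟨v, hv⟩).1 hf)
    have h1 := hsdu hu i hi
    rw [hiv] at h1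
    simp only at h1
    obtain ⟨u', h0, hu'⟩ := hu.exists_start ⟨i, hi, hiv, by
      split_ifs at h1 <;> omega⟩
    exact ⟨u', by rw [h0], hu'⟩
  have hnext : ∀ {u : ℕ → Fin n}, IsSpine S spine k u → ∀ i, i + 1 < k →
      (u (i + 1) : ℕ) = nb (u i) - if i = 0 then 0 else (u (i - 1) : ℕ) := by
    intro u hu i hi
    rw [hnbu hu i (by omega), if_pos hi]
    omega
  obtain ⟨t, s, hrun, ht, v₀, b, hv₀, hfv₀, hsv₀, hbu, hcoord⟩ :=
    RealRAM.runs_draw (inputState n L W) n W.length k A B flag sd nb cnt rfl rfl rfl rfl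
    (by
      intro a ha
      obtain ⟨a, rfl⟩ := Nat.exists_eq_add_of_le' ha
      rfl) (fun _ => rfl) hkf hkn rfl rfl rfl
    (by
      refine ⟨u 0, (u 0).2, (hfs _).2 (hu.flag_apply 0 hk), ?_⟩
      rw [hsdu hu 0 hk]
      split_ifs <;> omega)
    (by
      intro v hv hf hs
      obtain ⟨u', h0, hu'⟩ := hgood v hv hf hs
      refine ⟨fun i => u' i, h0, hnext hu', fun i hi j hj hij => ?_⟩
      have := hu'.inj i hi j (hj.trans hi) (Fin.ext hij)
      omega)
  obtain ⟨u', h0, hu'⟩ := hgood v₀ hv₀ hfv₀ hsv₀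
  obtain ⟨l, hln, hls, hlp, hslot, hslot', hrad, hstart⟩ := exists_blockLayout hu' hk hfs hnbl hcnt
    (fun i hi => hbu (fun i => u' i) h0 (hnext hu') i hi)
  have hpos : outputDrawing n s = l.pos := by
    funext v
    have h1 : s.real 0 v = -(4 * (n + 1) * l.rad v * Real.cos (l.slot v * RealRAM.slotAngle n)) ∧
        s.real 1 v = 4 * (n + 1) * l.rad v * Real.sin (l.slot v * RealRAM.slotAngle n) := by
      refine hcoord v v.2 (l.slot v) (l.rad v) (fun hf => ?_) (fun hf => ?_)
      · have hv := (hfs v).1 hf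
        exact ⟨hslot v hv, BlockLayout.rad_of_spine (hls ▸ hv)⟩
      · have hv : ¬ spine v := fun h => hf ((hfs v).2 h)
        exact ⟨hslot' v hv, hrad v hv⟩
    rw [outputDrawing, h1.1, h1.2, BlockLayout.pos, BlockLayout.radius, BlockLayout.unit, hln]
    rfl
  have hn : 0 < n := (Nat.zero_le _).trans_lt hv₀
  refine ⟨t, s, hrun, ht.trans ?_, ?_⟩
  · have hWm : W.length ≤ G.edgeSet.ncard := by
      rw [length_eq_ncard hW]
      exact Set.ncard_le_ncard (SimpleGraph.edgeSet_mono hSG) (Set.toFinite _)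
    have h1 : n + W.length + 1 ≤ 2 * (n + G.edgeSet.ncard) := by omega
    calc RealRAM.drawCost * (n + W.length + 1)
        ≤ RealRAM.drawCost * (2 * (n + G.edgeSet.ncard)) := Nat.mul_le_mul_left _ h1
      _ = 2 * RealRAM.drawCost * (n + G.edgeSet.ncard) := by ring
      _ ≤ _ := Nat.mul_le_mul_right _ (by omega)
  rw [hpos]
  have hspine_of : ∀ v, v ∈ spineSet S → l.spine v := fun v hv => by
    rw [hls, hspine]
    exact Or.inl hv
  refine ⟨BlockLayout.isCompatibleDrawing fun x y hxy => ?_, ?_, BlockLayout.hasUnitResolution, ?_⟩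
  · rw [hls]
    by_cases hx : spine x
    · by_cases hy : spine y
      · obtain ⟨i, hi, rfl⟩ := hu'.surj x hx
        obtain ⟨j, hj, rfl⟩ := hu'.surj y hy
        refine Or.inr (Or.inr ⟨hx, hy, ?_⟩)
        rcases (hu'.adj_iff i hi j hj).1 hxy with rfl | rfl
        · exact Or.inl (hstart i hj)
        · exact Or.inr (hstart j hi)
      · exact Or.inr (Or.inl ⟨hy, (hlp y x hy hxy.symm).symm⟩)
    · exact Or.inl ⟨hx, (hlp x y hx hxy).symm⟩
  -- For `n = 2` both vertices are leaves, yet one was drawn as a spine vertex on the circle.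
  -- Enlarging the circle puts it strictly inside, and the spine conditions are vacuous.
  · refine ⟨0, if n = 2 then l.radius + 1 else l.radius, ?_, fun v hv => ⟨?_, ?_, ?_⟩,
      fun v hv => ?_, fun v hv => ?_⟩
    · have := BlockLayout.radius_pos (l := l)
      split_ifs <;> linarith
    · rw [if_neg fun h => hv (htwo h v), BlockLayout.dist_pos_zero,
        BlockLayout.rad_of_spine (hspine_of v hv), mul_one]
    · exact (BlockLayout.pos_mem_box (l := l) v).2.1
    · exact (BlockLayout.pos_mem_box (l := l) v).2.2.1
    · rw [BlockLayout.dist_pos_zero]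
      have hR := BlockLayout.radius_pos (l := l)
      split_ifs with h2
      · have := mul_le_of_le_one_right hR.le (BlockLayout.rad_le_one (l := l) v)
        linarith
      · refine mul_lt_of_lt_one_right hR (BlockLayout.rad_lt_one ?_)
        rw [hls, hspine]
        rintro (h | h)
        · exact h hv
        · have := v.2
          omega
    · refine (BlockLayout.cospherical (l := l) v).subset (Set.image_mono ?_)
      rintro w ⟨hw, hvw⟩
      have hw' : ¬ spine w := by
        rw [hspine]
        rintro (h | h)
        · exact h hw
        · have h2 : n ≠ 2 := fun h2 => hv (htwo h2 v)
          have := w.2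
          omega
      exact ⟨by rwa [hls], hlp w v hw' hvw.symm⟩
  · have : Nonempty (Fin n) := ⟨⟨0, hn⟩⟩
    refine (drawingArea_le G (BlockLayout.pos_mem_box (l := l))).trans ?_
    rw [BlockLayout.radius, hln]
    have h1 : (1 : ℝ) ≤ n := by exact_mod_cast hn
    have h2 : (0 : ℝ) ≤ RealRAM.drawCost := Nat.cast_nonneg _
    push_cast
    have h3 : (4 * ((n : ℝ) + 1)) ^ 2 ≤ 64 * (n : ℝ) ^ 2 := by nlinarith
    nlinarith [mul_nonneg h2 (sq_nonneg (n : ℝ))]
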